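/- Let $n\ge 0$ and let $w$ be a permutation in the symmetric group $S_n$, written in 1-line notation $w=[w_1w_2\dots w_n]$, and let $s_1,\dots,s_{n-1}$ be the adjacent transpositions, where $s_i$ exchanges $i$ and $i+1$. An expression is a word in the $s_i$; it is reduced if no shorter word represents the same permutation. *Patterns.* For $p\in S_k$, an instance of $p$ in $w$ is a sequence $1\le i_1<\dots<i_k\le n$ such that for all $a<b$, $w_{i_a}<w_{i_b}$ if and only if $p_a<p_b$; $w$ avoids $p$ as a 1-line pattern if it has no instance of $p$. Let $N(w)$ be the number of instances of $[321]$ in $w$. *Freely-braided and maximally-clustered.* A short-braid is an expression $s_is_{i\pm1}s_i$. A braid cluster of length $2k+1$ is an expression $s_{i_1}\cdots s_{i_k}s_{i_{k+1}}s_{i_k}\cdots s_{i_1}$ in which for each $1\le p\le k$ there is a unique $q$ with $p<q\le k+1$ and $|i_p-i_q|=1$. The permutation $w$ is freely-braided if it has a reduced expression containing $N(w)$ disjoint short-braids as consecutive factors. It is maximally-clustered if it has a reduced expression $a_0c_1a_1c_2a_2\cdots c_Ma_M$ in which each $a_i$ is a reduced expression, each $c_i$ is a braid cluster of length $2n_i+1$,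 and $N(w)=\sum_{i=1}^M n_i$. *Hexagon-avoiding.* The heap of a reduced expression $x_1\cdots x_r$ is the set $\{1,\dots,r\}$, with $i$ labelled by the generator $x_i$, partially ordered by the transitive closure of the relation "$i<j$ and $x_i$, $x_j$ do not commute". The permutation $w\in S_n$ heap-contains $h\in S_k$ if there are a reduced expression $\mathsf w$ of $w$, a reduced expression $\mathsf h$ of $h$, and an injective map $f:\{s_1,\dots,s_{k-1}\}\to\{s_1,\dots,s_{n-1}\}$ that preserves the order of the subscripts and satisfies $(s_is_j)^m=1\iff(f(s_i)f(s_j))^m=1$ for all $i,j$ and $m\in\{2,3\}$, such that the heap of $f(\mathsf h)$ is isomorphic, as a labelled poset, to a convex induced subposet of the heap of $\mathsf w$. The permutation $w$ is hexagon-avoiding if it does not heap-contain $[46718235]=s_5s_6s_7s_3s_4s_5s_6s_2s_3s_4s_5s_1s_2s_3$. **Claim.** (1) $w$ is freely-braided and hexagon-avoiding if and only if $w$ avoids $$[3421],\ [4231],\ [4312],\ [4321],\ [46718235],\ [46781235],\ [56718234],\ [56781234]$$ as 1-line patterns. (2) $w$ is maximally-clustered and hexagon-avoiding if and only if $w$ avoids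 $$[3421],\ [4312],\ [4321],\ [46718235],\ [46781235],\ [56718234],\ [56781234]$$ as 1-line patterns. -/

import Mathlib

open Equiv (Perm)

namespace HexPerm

/-! ### Permutations, 1-line notation and pattern containment -/

/-- The permutation of `{1, …, k}` (modelled by `Fin k`, so shifted by one) whose 1-line notation
is `[v 0, v 1, …, v (k - 1)]`, with the usual 1-based entries. -/
noncomputable def oneLine {k : ℕ} (v : Fin k → ℕ) (hv : ∀ i, 1 ≤ v i ∧ v i ≤ k)
    (hinj : Function.Injective v) : Perm (Fin k) :=
  Equiv.ofBijective (fun i => (⟨v i - 1, by have := hv i; omega⟩ : Fin k))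
    (Finite.injective_iff_bijective.mp (fun i j hij => hinj (by
      have h1 := hv i
      have h2 := hv j
      have h3 : v i - 1 = v j - 1 := congrArg Fin.val hij
      omega)))

/-- `i = (i_1 < ⋯ < i_k)` is an instance of the pattern `p` in `w`. -/
def IsInstance {n k : ℕ} (w : Perm (Fin n)) (p : Perm (Fin k)) (i : Fin k → Fin n) : Prop :=
  StrictMono i ∧ ∀ a b : Fin k, a < b → (w (i a) < w (i b) ↔ p a < p b)

/-- `w` contains `p` as a 1-line pattern. -/
def ContainsPattern {n k : ℕ} (w : Perm (Fin n)) (p : Perm (Fin k)) : Prop :=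
  ∃ i : Fin k → Fin n, IsInstance w p i

/-- `w` avoids `p` as a 1-line pattern. -/
def Avoids {n k : ℕ} (w : Perm (Fin n)) (p : Perm (Fin k)) : Prop :=
  ¬ ContainsPattern w p

noncomputable def p321 : Perm (Fin 3) := oneLine ![3, 2, 1] (by decide) (by decide)
noncomputable def p3421 : Perm (Fin 4) := oneLine ![3, 4, 2, 1] (by decide) (by decide)
noncomputable def p4231 : Perm (Fin 4) := oneLine ![4, 2, 3, 1] (by decide) (by decide)
noncomputable def p4312 : Perm (Fin 4) := oneLine ![4, 3, 1, 2] (by decide) (by decide)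
noncomputable def p4321 : Perm (Fin 4) := oneLine ![4, 3, 2, 1] (by decide) (by decide)
noncomputable def p46718235 : Perm (Fin 8) :=
  oneLine ![4, 6, 7, 1, 8, 2, 3, 5] (by decide) (by decide)
noncomputable def p46781235 : Perm (Fin 8) :=
  oneLine ![4, 6, 7, 8, 1, 2, 3, 5] (by decide) (by decide)
noncomputable def p56718234 : Perm (Fin 8) :=
  oneLine ![5, 6, 7, 1, 8, 2, 3, 4] (by decide) (by decide)
noncomputable def p56781234 : Perm (Fin 8) :=
  oneLine ![5, 6, 7, 8, 1, 2, 3, 4] (by decide) (by decide)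

/-- `N(w)`: the number of `[321]` pattern instances in `w`. -/
noncomputable def num321 {n : ℕ} (w : Perm (Fin n)) : ℕ :=
  Nat.card {i : Fin 3 → Fin n // IsInstance w p321 i}

/-! ### Expressions in the adjacent transpositions -/

/-- The adjacent transposition `s_{i+1}`, exchanging the (0-based) points `i` and `i + 1`. -/
def gen {n : ℕ} (i : Fin (n - 1)) : Perm (Fin n) :=
  Equiv.swap ⟨i.val, by have := i.isLt; omega⟩ ⟨i.val + 1, by have := i.isLt; omega⟩

/-- An expression: a word in the indices of the generators of the symmetric group. -/
abbrev Expr (n : ℕ) : Type := List (Fin (n - 1))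

/-- The permutation represented by an expression. -/
def Expr.eval {n : ℕ} (x : Expr n) : Perm (Fin n) := (x.map gen).prod

/-- An expression is reduced if no expression for the same permutation is shorter. -/
def IsReduced {n : ℕ} (x : Expr n) : Prop :=
  ∀ y : Expr n, Expr.eval y = Expr.eval x → x.length ≤ y.length

/-- `x` is a reduced expression for `w`. -/
def IsReducedExpr {n : ℕ} (x : Expr n) (w : Perm (Fin n)) : Prop :=
  Expr.eval x = w ∧ IsReduced x

/-! ### Heaps -/

/-- The strict order of the heap of `x`, on the positions of `x`: the transitive closure of
`i < j` with non-commuting letters.  The position `i` is labelled by `x.get i`. -/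
def heapLT {n : ℕ} (x : Expr n) : Fin x.length → Fin x.length → Prop :=
  Relation.TransGen (fun i j => i < j ∧ ¬ Commute (gen (x.get i)) (gen (x.get j)))

/-- Orientation preserving Coxeter embeddings `{s_1, …, s_{k-1}} → {s_1, …, s_{n-1}}`. -/
structure IsCoxeterEmbedding {k n : ℕ} (f : Fin (k - 1) → Fin (n - 1)) : Prop where
  injective : Function.Injective f
  order_iff : ∀ m : ℕ, m = 2 ∨ m = 3 → ∀ i j : Fin (k - 1),
    ((gen i * gen j : Perm (Fin k)) ^ m = 1 ↔ (gen (f i) * gen (f j) : Perm (Fin n)) ^ m = 1)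
  orientation : ∀ i j : Fin (k - 1), i < j → f i < f j

/-- The heap of `y` is (isomorphic to) a convex labelled subposet of the heap of `x`, through
the map `g` of positions. -/
structure IsConvexSubheap {n : ℕ} (y x : Expr n) (g : Fin y.length → Fin x.length) : Prop where
  injective : Function.Injective g
  label : ∀ i, x.get (g i) = y.get i
  order_iff : ∀ i j, heapLT x (g i) (g j) ↔ heapLT y i j
  convex : ∀ (i j : Fin y.length) (z : Fin x.length),
    heapLT x (g i) z → heapLT x z (g j) → z ∈ Set.range g

/-- `w` heap-contains `h`. -/
def HeapContains {n k : ℕ} (w : Perm (Fin n)) (h : Perm (Fin k)) : Prop :=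
  ∃ (x : Expr n) (y : Expr k) (f : Fin (k - 1) → Fin (n - 1)),
    IsReducedExpr x w ∧ IsReducedExpr y h ∧ IsCoxeterEmbedding f ∧
      ∃ g, IsConvexSubheap (y.map f : Expr n) x g

/-- `w` is hexagon-avoiding: it heap-avoids `[46718235]`. -/
def HexagonAvoiding {n : ℕ} (w : Perm (Fin n)) : Prop :=
  ¬ HeapContains w p46718235

/-! ### Maximally-clustered and freely-braided permutations -/

/-- The generators with indices `i` and `j` are joined by an edge of the Coxeter graph,
i.e. `|i - j| = 1`. -/
def Adjacent {n : ℕ} (i j : Fin (n - 1)) : Prop :=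
  i.val + 1 = j.val ∨ j.val + 1 = i.val

/-- `c` is a braid cluster `s_{i_1} ⋯ s_{i_k} s_{i_{k+1}} s_{i_k} ⋯ s_{i_1}`, of length `2k + 1`:
each `i_p` with `p ≤ k` has a unique `i_q` with `p < q ≤ k + 1` and `|i_p - i_q| = 1`. -/
def IsBraidCluster {n : ℕ} (k : ℕ) (c : Expr n) : Prop :=
  ∃ i : Fin (k + 1) → Fin (n - 1),
    c = List.ofFn i ++ (List.ofFn (fun p : Fin k => i p.castSucc)).reverse ∧
    ∀ p : Fin k, ∃! q : Fin (k + 1), p.castSucc < q ∧ Adjacent (i p.castSucc) (i q)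

/-- A short-braid `s_i s_{i ± 1} s_i`. -/
def IsShortBraid {n : ℕ} (c : Expr n) : Prop :=
  ∃ i j : Fin (n - 1), Adjacent i j ∧ c = [i, j, i]

/-- The expression `a_0 c_1 a_1 c_2 a_2 ⋯ c_M a_M`. -/
def interleave {n M : ℕ} (a : Fin (M + 1) → Expr n) (c : Fin M → Expr n) : Expr n :=
  a 0 ++ (List.ofFn (fun i : Fin M => c i ++ a i.succ)).flatten

/-- `w` is maximally-clustered: it has a reduced expression `a_0 c_1 a_1 ⋯ c_M a_M` in which each
`a_i` is reduced, each `c_i` is a braid cluster of length `2 n_i + 1`, and `N(w) = ∑ n_i`. -/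
def MaximallyClustered {n : ℕ} (w : Perm (Fin n)) : Prop :=
  ∃ (M : ℕ) (a : Fin (M + 1) → Expr n) (c : Fin M → Expr n) (m : Fin M → ℕ),
    IsReducedExpr (interleave a c) w ∧ (∀ i, IsReduced (a i)) ∧
      (∀ i, IsBraidCluster (m i) (c i)) ∧ num321 w = ∑ i, m i

/-- `w` is freely-braided: it has a reduced expression with `N(w)` disjoint short-braids
(consecutive factors of the expression). -/
def FreelyBraided {n : ℕ} (w : Perm (Fin n)) : Prop :=
  ∃ (a : Fin (num321 w + 1) → Expr n) (c : Fin (num321 w) → Expr n),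
    IsReducedExpr (interleave a c) w ∧ ∀ i, IsShortBraid (c i)

end HexPerm

namespace HexPerm

/-- The pair of positions `(i, j)` is an inversion of `w`. -/
def IsInv {n : ℕ} (w : Perm (Fin n)) (i j : Fin n) : Prop := i < j ∧ w j < w i

theorem apply_inv {n : ℕ} (w : Perm (Fin n)) (a : Fin n) : w (w⁻¹ a) = a := by simp

theorem inv_apply {n : ℕ} (w : Perm (Fin n)) (a : Fin n) : w⁻¹ (w a) = a := by simp

open Classical in
/-- The finite set of inversions. -/
noncomputable def invs {n : ℕ} (w : Perm (Fin n)) : Finset (Fin n × Fin n) :=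
  Finset.univ.filter fun x => IsInv w x.1 x.2

/-- The number of inversions. -/
noncomputable def len {n : ℕ} (w : Perm (Fin n)) : ℕ := (invs w).card

theorem mem_invs {n : ℕ} {w : Perm (Fin n)} {x : Fin n × Fin n} :
    x ∈ invs w ↔ IsInv w x.1 x.2 := by
  simp [invs]

/-- Exchanging the entries at the positions `i < j` creates as many inversions as possible. -/
structure IsBlock {n : ℕ} (u : Perm (Fin n)) (i j : Fin n) : Prop where
  lt : i < j
  lt_apply : u i < u j
  between : ∀ k, u i < u k → u k < u j → i < k ∧ k < j

/-- The number of values strictly between the ends of a block. -/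
def gap {n : ℕ} (u : Perm (Fin n)) (i j : Fin n) : ℕ := (u j).val - (u i).val - 1

/-- The positions whose values lie strictly between the ends of a block. -/
def mids {n : ℕ} (u : Perm (Fin n)) (i j : Fin n) : Finset (Fin n) :=
  (Finset.Ioo (u i) (u j)).map u⁻¹.toEmbedding

theorem mem_mids {n : ℕ} {u : Perm (Fin n)} {i j k : Fin n} :
    k ∈ mids u i j ↔ u i < u k ∧ u k < u j := by
  simp only [mids, Finset.mem_map, Finset.mem_Ioo]
  constructor
  · rintro ⟨a, h, rfl⟩
    simpa using h
  · intro h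
    exact ⟨u k, h, by simp⟩

theorem card_mids {n : ℕ} (u : Perm (Fin n)) (i j : Fin n) : (mids u i j).card = gap u i j := by
  simp [mids, gap]

theorem IsBlock.isInv_iff {n : ℕ} {u : Perm (Fin n)} {i j : Fin n} (h : IsBlock u i j)
    (a b : Fin n) : IsInv (u * Equiv.swap i j) a b ↔
      IsInv u a b ∨ (a = i ∧ b = j) ∨ (a = i ∧ b ∈ mids u i j) ∨ (b = j ∧ a ∈ mids u i j) := by
  obtain ⟨h1, h2, h3⟩ := h
  have inj : ∀ x y, u x = u y → x = y := fun x y e => u.injective e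
  simp only [IsInv, mem_mids, Perm.mul_apply, Equiv.swap_apply_def]
  have ha := h3 a
  have hb := h3 b
  have i1 := inj a i
  have i2 := inj a j
  have i3 := inj b i
  have i4 := inj b j
  grind

theorem IsBlock.isInv_mono {n : ℕ} {u : Perm (Fin n)} {i j : Fin n} (h : IsBlock u i j)
    {a b : Fin n} (hab : IsInv u a b) : IsInv (u * Equiv.swap i j) a b :=
  (h.isInv_iff a b).2 (Or.inl hab)

theorem IsBlock.len_mul_swap {n : ℕ} {u : Perm (Fin n)} {i j : Fin n} (h : IsBlock u i j) :
    len (u * Equiv.swap i j) = len u + (2 * gap u i j + 1) := by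
  classical
  have e : invs (u * Equiv.swap i j) = invs u ∪ ({(i, j)} ∪
      ((mids u i j).image (fun k => (i, k)) ∪ (mids u i j).image (fun k => (k, j)))) := by
    ext ⟨a, b⟩
    rw [mem_invs, h.isInv_iff]
    simp only [Finset.mem_union, mem_invs, Finset.mem_singleton, Prod.mk.injEq, Finset.mem_image]
    grind
  have hb := h.between
  have hl := h.lt_apply
  rw [len, e, Finset.card_union_of_disjoint, Finset.card_union_of_disjoint,
    Finset.card_union_of_disjoint, Finset.card_image_of_injective, Finset.card_image_of_injective,
    card_mids, Finset.card_singleton, len]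
  · ring
  · intro x y hxy
    simpa using hxy
  · intro x y hxy
    simpa using hxy
  · rw [Finset.disjoint_left]
    simp only [Finset.mem_image, mem_mids]
    rintro ⟨a, b⟩ ⟨k, hk, e1⟩ ⟨l, hl, e2⟩
    simp only [Prod.mk.injEq] at e1 e2
    grind
  · rw [Finset.disjoint_left]
    simp only [Finset.mem_union, Finset.mem_image, mem_mids, Finset.mem_singleton]
    rintro ⟨a, b⟩ e0 (⟨k, hk, e1⟩ | ⟨l, hl, e1⟩) <;>
    · simp only [Prod.mk.injEq] at e0 e1
      grind
  · rw [Finset.disjoint_left]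
    simp only [Finset.mem_union, Finset.mem_image, mem_mids, Finset.mem_singleton, mem_invs, IsInv]
    rintro ⟨a, b⟩ e0 (e1 | ⟨k, hk, e1⟩ | ⟨l, hl, e1⟩) <;>
    · simp only [Prod.mk.injEq] at e1
      grind

/-! ### Words and inversions -/

/-- The left point moved by a generator. -/
def lo {n : ℕ} (k : Fin (n - 1)) : Fin n := ⟨k.val, by have := k.isLt; omega⟩

/-- The right point moved by a generator. -/
def hi {n : ℕ} (k : Fin (n - 1)) : Fin n := ⟨k.val + 1, by have := k.isLt; omega⟩

theorem gen_eq {n : ℕ} (k : Fin (n - 1)) : gen k = Equiv.swap (lo k) (hi k) := rfl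

theorem lo_lt_hi {n : ℕ} (k : Fin (n - 1)) : lo k < hi k := by
  simp [lo, hi, Fin.lt_def]

theorem gen_mul_gen {n : ℕ} (k : Fin (n - 1)) : (gen k * gen k : Perm (Fin n)) = 1 := by
  simp [gen]

theorem gen_inv {n : ℕ} (k : Fin (n - 1)) : (gen k : Perm (Fin n))⁻¹ = gen k := by
  simp [gen]

theorem gen_mul_eq {n : ℕ} (k : Fin (n - 1)) (u : Perm (Fin n)) :
    gen k * u = u * Equiv.swap (u⁻¹ (lo k)) (u⁻¹ (hi k)) := by
  rw [Equiv.mul_swap_eq_swap_mul]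
  simp [gen_eq]

theorem isBlock_of_ascent {n : ℕ} {k : Fin (n - 1)} {u : Perm (Fin n)}
    (h : u⁻¹ (lo k) < u⁻¹ (hi k)) : IsBlock u (u⁻¹ (lo k)) (u⁻¹ (hi k)) := by
  refine ⟨h, by simpa using lo_lt_hi k, fun l h1 h2 => ?_⟩
  simp only [apply_inv, lo, hi, Fin.lt_def] at h1 h2
  omega

theorem gap_ascent {n : ℕ} (k : Fin (n - 1)) (u : Perm (Fin n)) :
    gap u (u⁻¹ (lo k)) (u⁻¹ (hi k)) = 0 := by
  simp [gap, lo, hi]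

theorem len_gen_mul {n : ℕ} {k : Fin (n - 1)} {u : Perm (Fin n)}
    (h : u⁻¹ (lo k) < u⁻¹ (hi k)) : len (gen k * u) = len u + 1 := by
  rw [gen_mul_eq, (isBlock_of_ascent h).len_mul_swap, gap_ascent]

theorem len_gen_mul_of_descent {n : ℕ} {k : Fin (n - 1)} {u : Perm (Fin n)}
    (h : u⁻¹ (hi k) < u⁻¹ (lo k)) : len (gen k * u) + 1 = len u := by
  have : ((gen k * u)⁻¹ (lo k)) < ((gen k * u)⁻¹ (hi k)) := by
    simpa [gen_inv, gen_eq, Perm.mul_apply] using h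
  have := len_gen_mul this
  rw [← mul_assoc, gen_mul_gen, one_mul] at this
  exact this.symm

theorem ascent_or_descent {n : ℕ} (k : Fin (n - 1)) (u : Perm (Fin n)) :
    u⁻¹ (lo k) < u⁻¹ (hi k) ∨ u⁻¹ (hi k) < u⁻¹ (lo k) :=
  lt_or_gt_of_ne fun h => (lo_lt_hi k).ne (u⁻¹.injective h)

theorem len_gen_mul_le {n : ℕ} (k : Fin (n - 1)) (u : Perm (Fin n)) :
    len (gen k * u) ≤ len u + 1 := by
  rcases ascent_or_descent k u with h | h
  · exact (len_gen_mul h).le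
  · have := len_gen_mul_of_descent h
    omega

theorem len_one {n : ℕ} : len (1 : Perm (Fin n)) = 0 := by
  rw [len, Finset.card_eq_zero, Finset.eq_empty_iff_forall_notMem]
  rintro ⟨a, b⟩ h
  rw [mem_invs] at h
  exact absurd h.1 (not_lt.2 h.2.le)

theorem eval_nil {n : ℕ} : Expr.eval ([] : Expr n) = 1 := rfl

theorem eval_cons {n : ℕ} (k : Fin (n - 1)) (x : Expr n) :
    Expr.eval (k :: x : Expr n) = gen k * Expr.eval x := by
  simp [Expr.eval]

theorem eval_append {n : ℕ} (x y : Expr n) :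
    Expr.eval (x ++ y : Expr n) = Expr.eval x * Expr.eval y := by
  simp [Expr.eval]

theorem eval_reverse {n : ℕ} (x : Expr n) : Expr.eval (x.reverse : Expr n) = (Expr.eval x)⁻¹ := by
  induction x with
  | nil => simp [Expr.eval]
  | cons k x ih => simp [eval_append, eval_cons, ih, eval_nil, gen_inv]

theorem len_eval_le {n : ℕ} (x : Expr n) : len (Expr.eval x) ≤ x.length := by
  induction x with
  | nil => simp [eval_nil, len_one]
  | cons k x ih =>
    rw [eval_cons, List.length_cons]
    exact (len_gen_mul_le k _).trans (by omega)

theorem exists_step {n : ℕ} {P : Fin n → Prop} {a b : Fin n} (hab : a ≤ b) (ha : P a)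
    (hb : ¬ P b) :
    ∃ k : Fin (n - 1), a ≤ lo k ∧ hi k ≤ b ∧ P (lo k) ∧ ¬ P (hi k) := by
  by_contra hcon
  push Not at hcon
  have hab' : a.val ≤ b.val := hab
  have key : ∀ d : ℕ, ∀ h : a.val + d < n, a.val + d ≤ b.val → P ⟨a.val + d, h⟩ := by
    intro d
    induction d with
    | zero => intro h _; simpa using ha
    | succ d ih =>
      intro h hd
      exact hcon ⟨a.val + d, by omega⟩ (by simp [lo, Fin.le_def])
        (by simp [hi, Fin.le_def]; omega) (ih (by omega) (by omega))
  have h := key (b.val - a.val) (by have := b.isLt; omega) (by omega)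
  apply hb
  convert h using 2
  omega

theorem exists_descent {n : ℕ} {w : Perm (Fin n)} {a b : Fin n} (h : IsInv w a b) :
    ∃ k : Fin (n - 1), a ≤ lo k ∧ hi k ≤ b ∧ w (hi k) < w (lo k) := by
  obtain ⟨k, h1, h2, h3, h4⟩ := exists_step (P := fun x => w b < w x) h.1.le h.2 (lt_irrefl _)
  exact ⟨k, h1, h2, by order⟩

theorem eq_one_of_no_inv {n : ℕ} {w : Perm (Fin n)} (h : ∀ a b, ¬ IsInv w a b) : w = 1 := by
  have hm : StrictMono w := fun a b hab => lt_of_not_ge fun hle =>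
    h a b ⟨hab, lt_of_le_of_ne hle fun e => hab.ne' (w.injective e)⟩
  ext x
  have := Subsingleton.elim (hm.orderIsoOfSurjective w w.surjective) (OrderIso.refl _)
  exact congrArg Fin.val (DFunLike.congr_fun this x)

theorem exists_descent_inv {n : ℕ} {w : Perm (Fin n)} (h : w ≠ 1) :
    ∃ k : Fin (n - 1), w⁻¹ (hi k) < w⁻¹ (lo k) := by
  by_contra hcon
  apply h
  rw [← inv_eq_one]
  refine eq_one_of_no_inv fun a b hab => hcon ?_
  obtain ⟨k, -, -, hk⟩ := exists_descent hab
  exact ⟨k, hk⟩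

theorem exists_expr {n : ℕ} (w : Perm (Fin n)) :
    ∃ x : Expr n, Expr.eval x = w ∧ x.length = len w := by
  induction hm : len w using Nat.strong_induction_on generalizing w with
  | _ m ih =>
    by_cases hw : w = 1
    · exact ⟨[], by simp [hw, eval_nil], by simp [← hm, hw, len_one]⟩
    · obtain ⟨k, hk⟩ := exists_descent_inv hw
      have hl := len_gen_mul_of_descent hk
      obtain ⟨x, hx, hx'⟩ := ih _ (by omega) (gen k * w) rfl
      exact ⟨k :: x, by rw [eval_cons, hx, ← mul_assoc, gen_mul_gen, one_mul],
        by rw [List.length_cons, hx']; omega⟩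

theorem isReduced_iff {n : ℕ} {x : Expr n} : IsReduced x ↔ len (Expr.eval x) = x.length := by
  constructor
  · intro h
    obtain ⟨y, hy, hl⟩ := exists_expr (Expr.eval x)
    exact le_antisymm (len_eval_le x) (hl ▸ h y hy)
  · intro h y hy
    rw [← h, ← hy]
    exact len_eval_le y

theorem IsReduced.of_cons {n : ℕ} {k : Fin (n - 1)} {x : Expr n}
    (h : IsReduced (k :: x : Expr n)) :
    IsReduced x ∧ (Expr.eval x)⁻¹ (lo k) < (Expr.eval x)⁻¹ (hi k) := by
  rw [isReduced_iff, eval_cons, List.length_cons] at h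
  have h1 := len_eval_le x
  rcases ascent_or_descent k (Expr.eval x) with ha | hd
  · rw [len_gen_mul ha] at h
    exact ⟨isReduced_iff.2 (by omega), ha⟩
  · have := len_gen_mul_of_descent hd
    omega

theorem IsReduced.of_append {n : ℕ} {x y : Expr n} (h : IsReduced (x ++ y : Expr n)) :
    IsReduced y ∧ ∀ a b, IsInv (Expr.eval y) a b → IsInv (Expr.eval (x ++ y : Expr n)) a b := by
  induction x with
  | nil => exact ⟨h, fun a b hab => hab⟩
  | cons k x ih =>
    obtain ⟨h1, h2⟩ := IsReduced.of_cons h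
    obtain ⟨h3, h4⟩ := ih h1
    refine ⟨h3, fun a b hab => ?_⟩
    rw [List.cons_append, eval_cons, gen_mul_eq]
    exact (isBlock_of_ascent h2).isInv_mono (h4 a b hab)

/-- In a reduced word no pair of strings crosses twice. -/
theorem IsReduced.lt_of_isInv {n : ℕ} {x y : Expr n} (h : IsReduced (x ++ y : Expr n))
    {a b : Fin n} (hab : IsInv (Expr.eval x) a b) :
    (Expr.eval y)⁻¹ a < (Expr.eval y)⁻¹ b := by
  refine lt_of_not_ge fun hle => ?_
  have hlt := lt_of_le_of_ne hle fun e => hab.1.ne' ((Expr.eval y)⁻¹.injective e)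
  have h1 := (h.of_append).2 _ _ (⟨hlt, by simpa using hab.1⟩ : IsInv (Expr.eval y) _ _)
  have h2 := h1.2
  rw [eval_append] at h2
  simp only [Perm.mul_apply, apply_inv] at h2
  exact absurd hab.2 (not_lt.2 h2.le)

theorem IsReduced.left {n : ℕ} {x y : Expr n} (h : IsReduced (x ++ y : Expr n)) : IsReduced x := by
  intro z hz
  have := h (z ++ y) (by rw [eval_append, eval_append, hz])
  simpa using this

/-! ### Decreasing triples -/

/-- The positions `i < j < k` carry a decreasing triple of entries of `w`. -/
def IsTriple {n : ℕ} (w : Perm (Fin n)) (i j k : Fin n) : Prop := IsInv w i j ∧ IsInv w j k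

open Classical in
/-- The finite set of decreasing triples. -/
noncomputable def triples {n : ℕ} (w : Perm (Fin n)) : Finset (Fin n × Fin n × Fin n) :=
  Finset.univ.filter fun x => IsTriple w x.1 x.2.1 x.2.2

theorem mem_triples {n : ℕ} {w : Perm (Fin n)} {x : Fin n × Fin n × Fin n} :
    x ∈ triples w ↔ IsTriple w x.1 x.2.1 x.2.2 := by
  simp [triples]

/-- The first two entries of a decreasing triple determine the last one. -/
def UniqueLast {n : ℕ} (w : Perm (Fin n)) : Prop :=
  ∀ i j k l, IsTriple w i j k → IsTriple w i j l → k = l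

/-- The last two entries of a decreasing triple determine the first one. -/
def UniqueFirst {n : ℕ} (w : Perm (Fin n)) : Prop :=
  ∀ i j k l, IsTriple w i k l → IsTriple w j k l → i = j

/-- The outer entries of a decreasing triple determine the middle one. -/
def UniqueMid {n : ℕ} (w : Perm (Fin n)) : Prop :=
  ∀ i j k l, IsTriple w i j l → IsTriple w i k l → j = k

theorem IsBlock.isTriple_mono {n : ℕ} {u : Perm (Fin n)} {i j : Fin n} (h : IsBlock u i j)
    {a b c : Fin n} (ht : IsTriple u a b c) : IsTriple (u * Equiv.swap i j) a b c :=
  ⟨h.isInv_mono ht.1, h.isInv_mono ht.2⟩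

theorem IsBlock.isTriple_mids {n : ℕ} {u : Perm (Fin n)} {i j k : Fin n} (h : IsBlock u i j)
    (hk : k ∈ mids u i j) : IsTriple (u * Equiv.swap i j) i k j :=
  ⟨(h.isInv_iff _ _).2 (by tauto), (h.isInv_iff _ _).2 (by tauto)⟩

/-- All decreasing triples created by exchanging the ends of a block have these as outer
entries. -/
def IsTight {n : ℕ} (u : Perm (Fin n)) (i j : Fin n) : Prop :=
  ∀ a b c, IsTriple (u * Equiv.swap i j) a b c →
    IsTriple u a b c ∨ (a = i ∧ c = j ∧ b ∈ mids u i j)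

open Classical in
theorem IsBlock.card_triples {n : ℕ} {u : Perm (Fin n)} {i j : Fin n} (h : IsBlock u i j) :
    (triples u).card + gap u i j ≤ (triples (u * Equiv.swap i j)).card ∧
      ((triples (u * Equiv.swap i j)).card ≤ (triples u).card + gap u i j ↔ IsTight u i j) := by
  have hd : Disjoint (triples u) ((mids u i j).image fun k => (i, k, j)) := by
    rw [Finset.disjoint_left]
    rintro ⟨a, b, c⟩ h1 h2
    simp only [Finset.mem_image, mem_mids, mem_triples, IsTriple, IsInv, Prod.mk.injEq] at h1 h2
    grind
  have hc : (triples u ∪ (mids u i j).image fun k => (i, k, j)).card =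
      (triples u).card + gap u i j := by
    rw [Finset.card_union_of_disjoint hd, Finset.card_image_of_injective, card_mids]
    intro x y hxy
    simpa using hxy
  have hs : (triples u ∪ (mids u i j).image fun k => (i, k, j)) ⊆
      triples (u * Equiv.swap i j) := by
    rintro ⟨a, b, c⟩ h1
    simp only [Finset.mem_union, mem_triples, Finset.mem_image, Prod.mk.injEq] at h1 ⊢
    rcases h1 with h1 | ⟨k, hk, rfl, rfl, rfl⟩
    · exact h.isTriple_mono h1
    · exact h.isTriple_mids hk
  rw [← hc]
  refine ⟨Finset.card_le_card hs, fun hle => ?_, fun ht => Finset.card_le_card ?_⟩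
  · intro a b c habc
    have : (a, b, c) ∈ triples (u * Equiv.swap i j) := mem_triples.2 habc
    rw [← Finset.eq_of_subset_of_card_le hs hle, Finset.mem_union, mem_triples,
      Finset.mem_image] at this
    simp only [Prod.mk.injEq] at this
    grind
  · rintro ⟨a, b, c⟩ h1
    simp only [Finset.mem_union, mem_triples, Finset.mem_image, Prod.mk.injEq] at h1 ⊢
    have := ht a b c h1
    grind

theorem IsTight.uniqueLast {n : ℕ} {u : Perm (Fin n)} {i j : Fin n} (h : IsTight u i j)
    (hu : UniqueLast u) : UniqueLast (u * Equiv.swap i j) := by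
  intro a b c d h1 h2
  have := hu a b c d
  have h3 := h _ _ _ h1
  have h4 := h _ _ _ h2
  simp only [IsTriple, IsInv, mem_mids] at this h3 h4
  grind

theorem IsTight.uniqueFirst {n : ℕ} {u : Perm (Fin n)} {i j : Fin n} (h : IsTight u i j)
    (hu : UniqueFirst u) : UniqueFirst (u * Equiv.swap i j) := by
  intro a b c d h1 h2
  have := hu a b c d
  have h3 := h _ _ _ h1
  have h4 := h _ _ _ h2
  simp only [IsTriple, IsInv, mem_mids] at this h3 h4
  grind

theorem IsTight.uniqueMid {n : ℕ} {u : Perm (Fin n)} {i j : Fin n} (h : IsTight u i j)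
    (hu : UniqueMid u) (hg : gap u i j ≤ 1) : UniqueMid (u * Equiv.swap i j) := by
  intro a b c d h1 h2
  have := hu a b c d
  have h3 := h _ _ _ h1
  have h4 := h _ _ _ h2
  rw [← card_mids, Finset.card_le_one] at hg
  have h5 := hg b
  have h6 := mem_mids (u := u) (i := i) (j := j) (k := b)
  have h7 := mem_mids (u := u) (i := i) (j := j) (k := c)
  simp only [IsTriple, IsInv] at this h3 h4
  grind

/-! ### Clustered factorizations -/

/-- `w` is obtained from the identity by exchanging the ends of blocks, whose gaps satisfy `P` and
add up to `m`. -/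
inductive Clustered {n : ℕ} (P : ℕ → Prop) : Perm (Fin n) → ℕ → Prop
  | one : Clustered P 1 0
  | block {u : Perm (Fin n)} {m : ℕ} {i j : Fin n} (hu : Clustered P u m) (h : IsBlock u i j)
      (hP : P (gap u i j)) : Clustered P (u * Equiv.swap i j) (m + gap u i j)

theorem not_isTriple_one {n : ℕ} {i j k : Fin n} : ¬ IsTriple (1 : Perm (Fin n)) i j k :=
  fun h => absurd h.1.1 (not_lt.2 h.1.2.le)

theorem Clustered.le_card {n : ℕ} {P : ℕ → Prop} {w : Perm (Fin n)} {m : ℕ}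
    (h : Clustered P w m) : m ≤ (triples w).card := by
  induction h with
  | one => exact Nat.zero_le _
  | block hu h hP ih => exact (Nat.add_le_add_right ih _).trans h.card_triples.1

theorem Clustered.unique {n : ℕ} {P : ℕ → Prop} {w : Perm (Fin n)} {m : ℕ}
    (h : Clustered P w m) (hm : (triples w).card ≤ m) :
    UniqueLast w ∧ UniqueFirst w ∧ ((∀ k, P k → k ≤ 1) → UniqueMid w) := by
  induction h with
  | one =>
    exact ⟨fun _ _ _ _ h => (not_isTriple_one h).elim, fun _ _ _ _ h => (not_isTriple_one h).elim,
      fun _ _ _ _ _ h => (not_isTriple_one h).elim⟩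
  | block hu h hP ih =>
    have h1 := hu.le_card
    have h2 := h.card_triples
    have ht := h2.2.1 (hm.trans (Nat.add_le_add_right h1 _))
    obtain ⟨i1, i2, i3⟩ := ih (by omega)
    exact ⟨ht.uniqueLast i1, ht.uniqueFirst i2, fun hp => ht.uniqueMid (i3 hp) (hp _ hP)⟩

theorem isBlock_mul_swap {n : ℕ} {w : Perm (Fin n)} {i j : Fin n} (h : IsInv w i j)
    (hb : ∀ k, w j < w k → w k < w i → i < k ∧ k < j) : IsBlock (w * Equiv.swap i j) i j := by
  refine ⟨h.1, by simpa using h.2, fun k h1 h2 => ?_⟩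
  simp only [Perm.mul_apply, Equiv.swap_apply_left, Equiv.swap_apply_right] at h1 h2
  have hi : k ≠ i := by rintro rfl; simp at h1
  have hj : k ≠ j := by rintro rfl; simp at h2
  rw [Equiv.swap_apply_of_ne_of_ne hi hj] at h1 h2
  exact hb k h1 h2

theorem isTight_of {n : ℕ} {w : Perm (Fin n)} {i j : Fin n} (h : IsInv w i j)
    (hb : ∀ k, w j < w k → w k < w i → i < k ∧ k < j)
    (ht : ∀ a b c, IsTriple w a b c →
      ((a = i ∧ b = j) ∨ (b = i ∧ c = j) ∨
        (∃ k, w j < w k ∧ w k < w i ∧ ((a = i ∧ b = k) ∨ (a = k ∧ b = j) ∨ (b = i ∧ c = k) ∨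
          (b = k ∧ c = j)))) → a = i ∧ c = j) :
    IsTight (w * Equiv.swap i j) i j := by
  have hB := isBlock_mul_swap h hb
  have e : w * Equiv.swap i j * Equiv.swap i j = w := by
    rw [mul_assoc, Equiv.swap_mul_self, mul_one]
  have hm : ∀ k, k ∈ mids (w * Equiv.swap i j) i j → w j < w k ∧ w k < w i := by
    intro k hk
    rw [mem_mids] at hk
    have hi : k ≠ i := by rintro rfl; simp at hk
    have hj : k ≠ j := by rintro rfl; simp at hk
    simpa [Equiv.swap_apply_of_ne_of_ne hi hj] using hk
  have hm' : ∀ k, w j < w k ∧ w k < w i → k ∈ mids (w * Equiv.swap i j) i j := by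
    rintro k ⟨h1, h2⟩
    rw [mem_mids]
    have hi : k ≠ i := by rintro rfl; simp at h2
    have hj : k ≠ j := by rintro rfl; simp at h1
    simpa [Equiv.swap_apply_of_ne_of_ne hi hj] using ⟨h1, h2⟩
  intro a b c habc
  have e1 := hB.isInv_iff a b
  have e2 := hB.isInv_iff b c
  rw [e] at habc e1 e2
  have h3 := ht a b c habc
  have h4 := hm' b
  by_cases hac : a = i ∧ c = j
  · right
    obtain ⟨rfl, rfl⟩ := hac
    exact ⟨rfl, rfl, h4 ⟨habc.2.2, habc.1.2⟩⟩
  · left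
    have h5 := mt h3 hac
    push Not at h5
    refine ⟨?_, ?_⟩
    · rcases e1.1 habc.1 with h | h | h | h
      · exact h
      · exact absurd h.2 (h5.1 h.1)
      · have := h5.2.2 b (hm b h.2).1 (hm b h.2).2
        exact absurd rfl (this.1 h.1)
      · have := h5.2.2 a (hm a h.2).1 (hm a h.2).2
        exact absurd h.1 (this.2.1 rfl)
    · rcases e2.1 habc.2 with h | h | h | h
      · exact h
      · exact absurd h.2 (h5.2.1 h.1)
      · have := h5.2.2 c (hm c h.2).1 (hm c h.2).2
        exact absurd rfl (this.2.2.1 h.1)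
      · have := h5.2.2 b (hm b h.2).1 (hm b h.2).2
        exact absurd h.1 (this.2.2.2 rfl)

theorem exists_tight_block {n : ℕ} {w : Perm (Fin n)} (h1 : w ≠ 1) (hl : UniqueLast w)
    (hf : UniqueFirst w) :
    ∃ i j, IsInv w i j ∧ IsBlock (w * Equiv.swap i j) i j ∧ IsTight (w * Equiv.swap i j) i j := by
  by_cases hd : ∀ k : Fin (n - 1), w⁻¹ (hi k) < w⁻¹ (lo k) → ∃ c,
      IsTriple w (w⁻¹ (hi k)) (w⁻¹ (lo k)) c ∨ IsTriple w c (w⁻¹ (hi k)) (w⁻¹ (lo k))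
  swap
  · push Not at hd
    obtain ⟨k, hk, hc⟩ := hd
    have hinv : IsInv w (w⁻¹ (hi k)) (w⁻¹ (lo k)) :=
      ⟨hk, by rw [apply_inv, apply_inv]; exact lo_lt_hi k⟩
    have hno : ∀ l, w (w⁻¹ (lo k)) < w l → w l < w (w⁻¹ (hi k)) → False := by
      intro l h1 h2
      simp only [apply_inv, lo, hi, Fin.lt_def] at h1 h2
      omega
    have hb : ∀ l, w (w⁻¹ (lo k)) < w l → w l < w (w⁻¹ (hi k)) →
        w⁻¹ (hi k) < l ∧ l < w⁻¹ (lo k) := fun l h1 h2 => (hno l h1 h2).elim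
    refine ⟨_, _, hinv, isBlock_mul_swap hinv hb, isTight_of hinv hb ?_⟩
    rintro a b c habc (⟨rfl, rfl⟩ | ⟨rfl, rfl⟩ | ⟨k, hk1, hk2, -⟩)
    · exact ((hc c).1 habc).elim
    · exact ((hc a).2 habc).elim
    · exact (hno k hk1 hk2).elim
  · have hne : (triples w).Nonempty := by
      obtain ⟨k, hk⟩ := exists_descent_inv h1
      obtain ⟨c, hc | hc⟩ := hd k hk
      · exact ⟨(_, _, _), mem_triples.2 hc⟩
      · exact ⟨(_, _, _), mem_triples.2 hc⟩
    obtain ⟨⟨i, b, j⟩, hm, hmin⟩ :=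
      Finset.exists_min_image (triples w) (fun x => (w x.1).val - (w x.2.2).val) hne
    have ht : IsTriple w i b j := mem_triples.1 hm
    have hmin' : ∀ x y z, IsTriple w x y z → (w x).val + (w j).val < (w i).val + (w z).val →
        False := by
      intro x y z hxyz hlt
      have := hmin (x, y, z) (mem_triples.2 hxyz)
      have h1 : (w z).val < (w y).val := hxyz.2.2
      have h2 : (w y).val < (w x).val := hxyz.1.2
      have h3 : (w j).val < (w b).val := ht.2.2
      have h4 : (w b).val < (w i).val := ht.1.2
      simp only at this
      omega
    have hinv : IsInv w i j := ⟨ht.1.1.trans ht.2.1, ht.2.2.trans ht.1.2⟩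
    have hb : ∀ k, w j < w k → w k < w i → i < k ∧ k < j := by
      intro k hk1 hk2
      have ki : k ≠ i := by rintro rfl; exact lt_irrefl _ hk2
      have kj : k ≠ j := by rintro rfl; exact lt_irrefl _ hk1
      constructor
      · by_contra hcon
        obtain ⟨s, s1, s2, s3, s4⟩ := exists_step (P := fun x => ¬ w⁻¹ x < i) (a := w j)
          (b := w k) hk1.le (by simpa using hinv.1.le)
          (by rw [inv_apply]; intro h; apply h; order)
        have hs := lo_lt_hi s
        rw [not_not] at s4
        obtain ⟨c, hc⟩ := hd s (by order)
        generalize hA : w⁻¹ (hi s) = A at *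
        generalize hB : w⁻¹ (lo s) = B at *
        have wA : w A = hi s := by rw [← hA, apply_inv]
        have wB : w B = lo s := by rw [← hB, apply_inv]
        have hBi : B ≠ i := by rintro rfl; order
        rcases hc with hc | hc
        · have h5 : IsTriple w i B c := ⟨⟨by order, by order⟩, hc.2⟩
          have := hf _ _ _ _ hc h5
          order
        · rcases lt_trichotomy (w c) (w i) with h6 | h6 | h6
          · refine hmin' _ _ _ hc ?_
            have h7 : (w c).val < (w i).val := h6
            have h8 : (w j).val ≤ (w B).val := by rw [wB]; exact s1
            omega
          · have := w.injective h6
            have := hc.1.1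
            order
          · have h7 : IsTriple w c b j :=
              ⟨⟨by have := hc.1.1; have := ht.1.1; order, h6.trans' ht.1.2⟩, ht.2⟩
            have := hf _ _ _ _ h7 ht
            have := hc.1.1
            order
      · by_contra hcon
        obtain ⟨s, s1, s2, s3, s4⟩ := exists_step (P := fun x => j < w⁻¹ x) (a := w k)
          (b := w i) hk2.le (by rw [inv_apply]; order)
          (by rw [inv_apply]; exact not_lt.2 hinv.1.le)
        have hs := lo_lt_hi s
        obtain ⟨c, hc⟩ := hd s (by order)
        generalize hA : w⁻¹ (hi s) = A at *
        generalize hB : w⁻¹ (lo s) = B at *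
        have wA : w A = hi s := by rw [← hA, apply_inv]
        have wB : w B = lo s := by rw [← hB, apply_inv]
        rw [not_lt] at s4
        have hAj : A ≠ j := by rintro rfl; order
        rcases hc with hc | hc
        · rcases lt_trichotomy (w c) (w j) with h6 | h6 | h6
          · have h7 : IsTriple w i b c :=
              ⟨ht.1, ⟨by have := hc.2.1; have := ht.2.1; order, h6.trans ht.2.2⟩⟩
            have := hl _ _ _ _ h7 ht
            have := hc.2.1
            order
          · have := w.injective h6
            have := hc.2.1
            order
          · refine hmin' _ _ _ hc ?_
            have h7 : (w j).val < (w c).val := h6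
            have h8 : (w A).val ≤ (w i).val := by rw [wA]; exact s2
            omega
        · have h5 : IsTriple w c A j := ⟨hc.1, ⟨by order, by order⟩⟩
          have := hl _ _ _ _ hc h5
          order
    refine ⟨i, j, hinv, isBlock_mul_swap hinv hb, isTight_of hinv hb ?_⟩
    have hmid : ∀ k, w j < w k → w k < w i → IsTriple w i k j := fun k k1 k2 =>
      ⟨⟨(hb k k1 k2).1, k2⟩, ⟨(hb k k1 k2).2, k1⟩⟩
    rintro x y z hxyz (⟨rfl, rfl⟩ | ⟨rfl, rfl⟩ | ⟨k, hk1, hk2, h⟩)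
    · have h7 : IsTriple w x b z :=
        ⟨ht.1, ⟨ht.2.1.trans hxyz.2.1, hxyz.2.2.trans ht.2.2⟩⟩
      exact ⟨rfl, hl _ _ _ _ h7 ht⟩
    · have h7 : IsTriple w x b z :=
        ⟨⟨hxyz.1.1.trans ht.1.1, ht.1.2.trans hxyz.1.2⟩, ht.2⟩
      exact ⟨hf _ _ _ _ h7 ht, rfl⟩
    · have hk := hmid k hk1 hk2
      rcases h with ⟨rfl, rfl⟩ | ⟨rfl, rfl⟩ | ⟨rfl, rfl⟩ | ⟨rfl, rfl⟩
      · exact ⟨rfl, hl _ _ _ _ hxyz hk⟩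
      · have h7 : IsTriple w i x z :=
          ⟨hk.1, ⟨hk.2.1.trans hxyz.2.1, hxyz.2.2.trans hk.2.2⟩⟩
        have := hl _ _ _ _ h7 hk
        have := hxyz.2.1
        order
      · have h7 : IsTriple w x z j :=
          ⟨⟨hxyz.1.1.trans hk.1.1, hk.1.2.trans hxyz.1.2⟩, hk.2⟩
        have := hf _ _ _ _ h7 hk
        have := hxyz.1.1
        order
      · exact ⟨hf _ _ _ _ hxyz hk, rfl⟩

theorem IsBlock.gap_le_one {n : ℕ} {u : Perm (Fin n)} {i j : Fin n} (h : IsBlock u i j)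
    (hm : UniqueMid (u * Equiv.swap i j)) : gap u i j ≤ 1 := by
  rw [← card_mids, Finset.card_le_one]
  intro a ha b hb
  exact hm _ _ _ _ (h.isTriple_mids ha) (h.isTriple_mids hb)

theorem clustered_of_unique {n : ℕ} {P : ℕ → Prop} {w : Perm (Fin n)} (hl : UniqueLast w)
    (hf : UniqueFirst w) (hP : (∀ k, P k) ∨ UniqueMid w ∧ ∀ k, k ≤ 1 → P k) :
    Clustered P w (triples w).card := by
  induction hm : len w using Nat.strong_induction_on generalizing w with
  | _ m ih =>
    by_cases hw : w = 1
    · subst hw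
      have : triples (1 : Perm (Fin n)) = ∅ :=
        Finset.eq_empty_of_forall_notMem fun x hx => not_isTriple_one (mem_triples.1 hx)
      rw [this]
      exact .one
    · obtain ⟨i, j, hi, hB, hT⟩ := exists_tight_block hw hl hf
      have e : w * Equiv.swap i j * Equiv.swap i j = w := by
        rw [mul_assoc, Equiv.swap_mul_self, mul_one]
      have hlen := hB.len_mul_swap
      have hcard := hB.card_triples
      have hmono : ∀ {a b c}, IsTriple (w * Equiv.swap i j) a b c → IsTriple w a b c := by
        intro a b c h
        have := hB.isTriple_mono h
        rwa [e] at this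
      have hg : UniqueMid w → gap (w * Equiv.swap i j) i j ≤ 1 := by
        intro h
        refine hB.gap_le_one ?_
        rwa [e]
      rw [e] at hlen hcard
      have h1 := ih _ (by omega) (w := w * Equiv.swap i j)
        (fun _ _ _ _ h h' => hl _ _ _ _ (hmono h) (hmono h'))
        (fun _ _ _ _ h h' => hf _ _ _ _ (hmono h) (hmono h'))
        (hP.imp_right fun h => ⟨fun _ _ _ _ h1 h' => h.1 _ _ _ _ (hmono h1) (hmono h'), h.2⟩) rfl
      have h2 := Clustered.block h1 hB (hP.elim (fun h => h _) fun h => h.2 _ (hg h.1))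
      rw [e] at h2
      rwa [le_antisymm (hcard.2.2 hT) hcard.1]

/-! ### Braid clusters and blocks -/

theorem isBlock_one {n : ℕ} {a b : Fin n} (h : a < b) : IsBlock (1 : Perm (Fin n)) a b :=
  ⟨h, h, fun _ h1 h2 => ⟨h1, h2⟩⟩

theorem eval_palindrome {n : ℕ} (l : Expr n) (j : Fin (n - 1)) :
    Expr.eval (l ++ j :: l.reverse : Expr n) =
      Equiv.swap (Expr.eval l (lo j)) (Expr.eval l (hi j)) := by
  rw [eval_append, eval_cons, eval_reverse, gen_eq, ← mul_assoc, Equiv.mul_swap_eq_swap_mul,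
    mul_assoc, mul_inv_cancel, mul_one]

theorem exists_block_of_palindrome {n : ℕ} {l z : Expr n} {j : Fin (n - 1)}
    (h : IsReduced ((l ++ j :: l.reverse) ++ z : Expr n)) :
    ∃ p q, IsBlock (Expr.eval z) p q ∧ gap (Expr.eval z) p q = l.length ∧
      Expr.eval ((l ++ j :: l.reverse) ++ z : Expr n) = Expr.eval z * Equiv.swap p q := by
  obtain ⟨a, b, hab, he⟩ : ∃ a b, a < b ∧
      Expr.eval (l ++ j :: l.reverse : Expr n) = Equiv.swap a b := by
    rw [eval_palindrome]
    rcases lt_or_gt_of_ne (fun e => (lo_lt_hi j).ne ((Expr.eval l).injective e)) with h | h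
    · exact ⟨_, _, h, rfl⟩
    · exact ⟨_, _, h, Equiv.swap_comm _ _⟩
  have hb := isBlock_one hab
  have hl := hb.len_mul_swap
  have hr := isReduced_iff.1 h.left
  rw [one_mul, len_one] at hl
  rw [he, hl] at hr
  simp only [List.length_append, List.length_cons, List.length_reverse] at hr
  have hinv : ∀ x y, IsInv (1 * Equiv.swap a b) x y →
      (Expr.eval z)⁻¹ x < (Expr.eval z)⁻¹ y := by
    intro x y hxy
    rw [one_mul, ← he] at hxy
    exact h.lt_of_isInv hxy
  have hg : gap (Expr.eval z) ((Expr.eval z)⁻¹ a) ((Expr.eval z)⁻¹ b) =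
      gap (1 : Perm (Fin n)) a b := by
    simp [gap]
  refine ⟨(Expr.eval z)⁻¹ a, (Expr.eval z)⁻¹ b, ⟨?_, by rwa [apply_inv, apply_inv], ?_⟩, ?_, ?_⟩
  · exact hinv _ _ ((hb.isInv_iff _ _).2 (by tauto))
  · intro k h1 h2
    rw [apply_inv] at h1 h2
    have hm : Expr.eval z k ∈ mids (1 : Perm (Fin n)) a b := mem_mids.2 ⟨h1, h2⟩
    have h3 := hinv _ _ ((hb.isInv_iff a (Expr.eval z k)).2 (by tauto))
    have h4 := hinv _ _ ((hb.isInv_iff (Expr.eval z k) b).2 (by tauto))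
    rw [inv_apply] at h3 h4
    exact ⟨h3, h4⟩
  · rw [hg]
    omega
  · rw [eval_append, he, Equiv.mul_swap_eq_swap_mul, apply_inv, apply_inv]

theorem Clustered.append {n : ℕ} {P : ℕ → Prop} (h0 : P 0) {x z : Expr n} {m : ℕ}
    (h : Clustered P (Expr.eval z) m) (hr : IsReduced (x ++ z : Expr n)) :
    Clustered P (Expr.eval (x ++ z : Expr n)) m := by
  induction x with
  | nil => exact h
  | cons k x ih =>
    obtain ⟨h1, h2⟩ := IsReduced.of_cons hr
    have := (ih h1).block (isBlock_of_ascent h2) (by rwa [gap_ascent])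
    rw [gap_ascent] at this
    rwa [List.cons_append, eval_cons, gen_mul_eq]

theorem interleave_zero {n : ℕ} (a : Fin 1 → Expr n) (c : Fin 0 → Expr n) :
    interleave a c = a 0 := by
  simp [interleave]

theorem interleave_succ {n M : ℕ} (a : Fin (M + 2) → Expr n) (c : Fin (M + 1) → Expr n) :
    interleave a c = a 0 ++ (c 0 ++ interleave (fun i => a i.succ) (fun i => c i.succ)) := by
  simp [interleave, List.ofFn_succ]

theorem clustered_interleave {n : ℕ} {P : ℕ → Prop} (h0 : P 0) {M : ℕ} {a : Fin (M + 1) → Expr n}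
    {c : Fin M → Expr n} {m : Fin M → ℕ} (hP : ∀ i, P (m i))
    (hc : ∀ i, ∃ (l : Expr n) (j : Fin (n - 1)), l.length = m i ∧ c i = l ++ j :: l.reverse)
    (hr : IsReduced (interleave a c)) :
    Clustered P (Expr.eval (interleave a c)) (∑ i, m i) := by
  induction M with
  | zero =>
    have h1 : Clustered P (Expr.eval ([] : Expr n)) 0 := .one
    rw [interleave_zero] at hr ⊢
    rw [← List.append_nil (a 0)] at hr ⊢
    simpa using h1.append h0 hr
  | succ M ih =>
    rw [interleave_succ] at hr ⊢
    have h1 := hr.of_append.1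
    have h2 := ih (fun i => hP i.succ) (fun i => hc i.succ) h1.of_append.1
    refine Clustered.append h0 ?_ hr
    obtain ⟨l, j, hl, hlj⟩ := hc 0
    rw [hlj] at h1 ⊢
    obtain ⟨p, q, h3, h4, h5⟩ := exists_block_of_palindrome h1
    have h6 := h2.block h3 (by rw [h4, hl]; exact hP 0)
    rw [h4, hl] at h6
    rw [h5, Fin.sum_univ_succ, add_comm (m 0)]
    exact h6

theorem IsBraidCluster.palindrome {n k : ℕ} {c : Expr n} (h : IsBraidCluster k c) :
    ∃ (l : Expr n) (j : Fin (n - 1)), l.length = k ∧ c = l ++ j :: l.reverse := by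
  obtain ⟨i, rfl, -⟩ := h
  refine ⟨List.ofFn fun p : Fin k => i p.castSucc, i (Fin.last k), by simp, ?_⟩
  rw [List.ofFn_succ']
  simp

theorem IsShortBraid.palindrome {n : ℕ} {c : Expr n} (h : IsShortBraid c) :
    ∃ (l : Expr n) (j : Fin (n - 1)), l.length = 1 ∧ c = l ++ j :: l.reverse := by
  obtain ⟨i, j, -, rfl⟩ := h
  exact ⟨[i], j, rfl, rfl⟩

theorem MaximallyClustered.clustered {n : ℕ} {w : Perm (Fin n)} (h : MaximallyClustered w) :
    Clustered (fun _ => True) w (num321 w) := by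
  obtain ⟨M, a, c, m, ⟨rfl, hr⟩, -, hc, hN⟩ := h
  rw [hN]
  exact clustered_interleave trivial (fun _ => trivial) (fun i => (hc i).palindrome) hr

theorem FreelyBraided.clustered {n : ℕ} {w : Perm (Fin n)} (h : FreelyBraided w) :
    Clustered (fun k => k ≤ 1) w (num321 w) := by
  obtain ⟨a, c, ⟨hw, hr⟩, hc⟩ := h
  have := clustered_interleave (P := fun k => k ≤ 1) (m := fun _ => 1) zero_le_one
    (fun _ => le_rfl) (fun i => (hc i).palindrome) hr
  rw [hw] at this
  simpa using this

/-- The word `s_p s_{p+1} ⋯ s_{p+K} ⋯ s_{p+1} s_p`. -/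
def clusterWord {n : ℕ} (p K : ℕ) (h : p + K < n - 1) : Expr n :=
  List.ofFn (fun j : Fin (K + 1) => (⟨p + j.val, by omega⟩ : Fin (n - 1))) ++
    (List.ofFn (fun j : Fin K => (⟨p + j.val, by omega⟩ : Fin (n - 1)))).reverse

theorem isBraidCluster_clusterWord {n p K : ℕ} (h : p + K < n - 1) :
    IsBraidCluster K (clusterWord p K h) := by
  refine ⟨fun j => ⟨p + j.val, by omega⟩, rfl, fun j => ⟨j.succ, ⟨?_, ?_⟩, ?_⟩⟩
  · simp [Fin.lt_def]
  · left
    simp [add_assoc]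
  · rintro q ⟨h1, h2⟩
    simp only [Adjacent, Fin.lt_def, Fin.val_castSucc] at h1 h2
    ext
    simp only [Fin.val_succ]
    omega

theorem length_clusterWord {n p K : ℕ} (h : p + K < n - 1) :
    (clusterWord p K h).length = 2 * K + 1 := by
  simp [clusterWord]
  ring

theorem clusterWord_succ {n p K : ℕ} (h : p + (K + 1) < n - 1) :
    clusterWord p (K + 1) h =
      (⟨p, by omega⟩ :: (clusterWord (p + 1) K (by omega) ++ [⟨p, by omega⟩]) : Expr n) := by
  simp only [clusterWord]
  rw [List.ofFn_succ,
    List.ofFn_succ (f := fun j : Fin (K + 1) => (⟨p + j.val, by omega⟩ : Fin (n - 1)))]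
  simp [add_assoc, add_comm 1]

theorem eval_clusterWord {n p K : ℕ} (h : p + K < n - 1) :
    Expr.eval (clusterWord p K h) =
      Equiv.swap (⟨p, by omega⟩ : Fin n) ⟨p + K + 1, by omega⟩ := by
  induction K generalizing p with
  | zero => simp [clusterWord, Expr.eval, gen]
  | succ K ih =>
    rw [clusterWord_succ, eval_cons, eval_append, ih (by omega), eval_cons, eval_nil, mul_one,
      ← mul_assoc, Equiv.mul_swap_eq_swap_mul, mul_assoc, gen_mul_gen, mul_one]
    have e1 : gen (⟨p, by omega⟩ : Fin (n - 1)) ⟨p + 1, by omega⟩ = (⟨p, by omega⟩ : Fin n) := by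
      simp [gen]
    have e2 : gen (⟨p, by omega⟩ : Fin (n - 1)) ⟨p + 1 + K + 1, by omega⟩ =
        (⟨p + (K + 1) + 1, by omega⟩ : Fin n) := by
      rw [gen, Equiv.swap_apply_of_ne_of_ne]
      · ext; simp only; omega
      · simp only [ne_eq, Fin.mk.injEq]; omega
      · simp only [ne_eq, Fin.mk.injEq]; omega
    rw [e1, e2]

theorem IsBlock.exists_cluster {n : ℕ} {u : Perm (Fin n)} {i j : Fin n} (h : IsBlock u i j) :
    ∃ c : Expr n, IsBraidCluster (gap u i j) c ∧ c.length = 2 * gap u i j + 1 ∧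
      Expr.eval c * u = u * Equiv.swap i j := by
  have h1 : (u i).val < (u j).val := h.lt_apply
  have h2 := (u j).isLt
  have h3 : (u i).val + gap u i j < n - 1 := by
    unfold gap
    omega
  refine ⟨clusterWord (u i).val (gap u i j) h3, isBraidCluster_clusterWord h3,
    length_clusterWord h3, ?_⟩
  rw [eval_clusterWord, Equiv.mul_swap_eq_swap_mul]
  congr 2
  ext
  simp only [gap]
  omega

theorem Clustered.exists_clusters {n : ℕ} {P : ℕ → Prop} {w : Perm (Fin n)} {m : ℕ}
    (h : Clustered P w m) : ∃ (M : ℕ) (c : Fin M → Expr n) (k : Fin M → ℕ),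
      Expr.eval (interleave (fun _ => []) c) = w ∧ (interleave (fun _ => []) c).length = len w ∧
        (∀ i, IsBraidCluster (k i) (c i)) ∧ m = ∑ i, k i := by
  induction h with
  | one => exact ⟨0, Fin.elim0, Fin.elim0, by simp [interleave_zero, eval_nil],
      by simp [interleave_zero, len_one], fun i => i.elim0, by simp⟩
  | @block u m i j hu h hP ih =>
    obtain ⟨M, c, k, h1, h2, h3, rfl⟩ := ih
    obtain ⟨d, d1, d2, d3⟩ := h.exists_cluster
    have e : interleave (fun _ => []) (Fin.cons d c : Fin (M + 1) → Expr n) =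
        d ++ interleave (fun _ => []) c := by
      simp [interleave_succ]
    refine ⟨M + 1, Fin.cons d c, Fin.cons (gap u i j) k, ?_, ?_, ?_, ?_⟩
    · rw [e, eval_append, h1, d3]
    · rw [e, List.length_append, h2, d2, h.len_mul_swap, add_comm]
    · intro s
      refine Fin.cases ?_ (fun s => ?_) s
      · simpa using d1
      · simpa using h3 s
    · rw [Fin.sum_univ_succ]
      simp [add_comm]

theorem Clustered.maximallyClustered {n : ℕ} {P : ℕ → Prop} {w : Perm (Fin n)}
    (h : Clustered P w (num321 w)) : MaximallyClustered w := by
  obtain ⟨M, c, k, h1, h2, h3, h4⟩ := h.exists_clusters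
  exact ⟨M, fun _ => [], c, k, ⟨h1, isReduced_iff.2 (by rw [h1, h2])⟩,
    fun _ y _ => Nat.zero_le _, h3, h4⟩

theorem IsBraidCluster.isShortBraid {n : ℕ} {c : Expr n} (h : IsBraidCluster 1 c) :
    IsShortBraid c := by
  obtain ⟨i, rfl, h⟩ := h
  obtain ⟨q, ⟨h1, h2⟩, -⟩ := h 0
  obtain rfl : q = 1 := by
    simp only [Fin.lt_def, Fin.val_castSucc] at h1
    ext
    have := q.isLt
    simp only [Fin.val_zero, Fin.val_one] at h1 ⊢
    omega
  exact ⟨i 0, i 1, h2, by simp [List.ofFn_succ]⟩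

theorem Clustered.exists_shortBraids {n : ℕ} {w : Perm (Fin n)} {m : ℕ}
    (h : Clustered (fun k => k ≤ 1) w m) : ∃ (a : Fin (m + 1) → Expr n) (c : Fin m → Expr n),
      Expr.eval (interleave a c) = w ∧ (interleave a c).length = len w ∧
        ∀ i, IsShortBraid (c i) := by
  induction h with
  | one => exact ⟨fun _ => [], Fin.elim0, by simp [interleave_zero, eval_nil],
      by simp [interleave_zero, len_one], fun i => i.elim0⟩
  | @block u m i j hu h hP ih =>
    obtain ⟨a, c, h1, h2, h3⟩ := ih
    obtain ⟨d, d1, d2, d3⟩ := h.exists_cluster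
    have hl := h.len_mul_swap
    generalize gap u i j = g at *
    obtain rfl | rfl : g = 0 ∨ g = 1 := by omega
    · have e : interleave (Fin.cons (d ++ a 0) fun i => a i.succ : Fin (m + 1) → Expr n) c =
          d ++ interleave a c := by
        cases m <;> simp [interleave_succ, interleave_zero]
      refine ⟨Fin.cons (d ++ a 0) fun i => a i.succ, c, ?_, ?_, h3⟩
      · rw [e, eval_append, h1, d3]
      · rw [e, List.length_append, h2, d2, hl, add_comm]
    · have e : interleave (Fin.cons [] a : Fin (m + 1 + 1) → Expr n)
          (Fin.cons d c : Fin (m + 1) → Expr n) = d ++ interleave a c := by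
        simp [interleave_succ]
      refine ⟨Fin.cons [] a, Fin.cons d c, ?_, ?_, ?_⟩
      · rw [e, eval_append, h1, d3]
      · rw [e, List.length_append, h2, d2, hl, add_comm]
      · intro s
        refine Fin.cases ?_ (fun s => ?_) s
        · simpa using d1.isShortBraid
        · simpa using h3 s

theorem Clustered.freelyBraided {n : ℕ} {w : Perm (Fin n)}
    (h : Clustered (fun k => k ≤ 1) w (num321 w)) : FreelyBraided w := by
  obtain ⟨a, c, h1, h2, h3⟩ := h.exists_shortBraids
  exact ⟨a, c, ⟨h1, isReduced_iff.2 (by rw [h1, h2])⟩, h3⟩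

/-! ### Patterns in one-line notation -/

theorem oneLine_lt {k : ℕ} {v : Fin k → ℕ} {hv : ∀ i, 1 ≤ v i ∧ v i ≤ k}
    {hinj : Function.Injective v} (a b : Fin k) :
    oneLine v hv hinj a < oneLine v hv hinj b ↔ v a < v b := by
  have h1 := hv a
  have h2 := hv b
  simp only [oneLine, Equiv.ofBijective_apply, Fin.lt_def]
  omega

theorem IsInstance.lt_iff {n k : ℕ} {w : Perm (Fin n)} {v : Fin k → ℕ}
    {hv : ∀ i, 1 ≤ v i ∧ v i ≤ k} {hinj : Function.Injective v} {i : Fin k → Fin n}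
    (h : IsInstance w (oneLine v hv hinj) i) (a b : Fin k) : w (i a) < w (i b) ↔ v a < v b := by
  rw [← oneLine_lt (hv := hv) (hinj := hinj)]
  rcases lt_trichotomy a b with hab | rfl | hab
  · exact h.2 a b hab
  · simp
  · have h1 := h.2 b a hab
    have h2 : w (i b) ≠ w (i a) := fun e => (h.1 hab).ne (w.injective e)
    have h3 : oneLine v hv hinj b ≠ oneLine v hv hinj a := fun e =>
      hab.ne (Equiv.injective _ e)
    rw [← not_iff_not, not_lt, not_lt, h2.le_iff_lt, h3.le_iff_lt]
    exact h1

theorem isInstance_of_strictMono {n k : ℕ} {w : Perm (Fin n)} {v : Fin k → ℕ}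
    {hv : ∀ i, 1 ≤ v i ∧ v i ≤ k} {hinj : Function.Injective v} {i : Fin k → Fin n}
    (hi : StrictMono i) (σ : Fin k → Fin k) (hσ : ∀ j, v (σ j) = j.val + 1)
    (hw : StrictMono fun j => w (i (σ j))) : IsInstance w (oneLine v hv hinj) i := by
  refine ⟨hi, fun a b _ => ?_⟩
  have key : ∀ a : Fin k, σ (oneLine v hv hinj a) = a := by
    intro a
    apply hinj
    have := hv a
    rw [hσ]
    simp only [oneLine, Equiv.ofBijective_apply]
    omega
  have := hw.lt_iff_lt (a := oneLine v hv hinj a) (b := oneLine v hv hinj b)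
  simpa only [key] using this

theorem strictMono_fin_three {α : Type*} [Preorder α] {f : Fin 3 → α} (h0 : f 0 < f 1)
    (h1 : f 1 < f 2) : StrictMono f := by
  rw [Fin.strictMono_iff_lt_succ]
  intro i
  fin_cases i <;> assumption

theorem strictMono_fin_four {α : Type*} [Preorder α] {f : Fin 4 → α} (h0 : f 0 < f 1)
    (h1 : f 1 < f 2) (h2 : f 2 < f 3) : StrictMono f := by
  rw [Fin.strictMono_iff_lt_succ]
  intro i
  fin_cases i <;> assumption

theorem isInstance_p321 {n : ℕ} {w : Perm (Fin n)} {i : Fin 3 → Fin n} :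
    IsInstance w p321 i ↔ IsTriple w (i 0) (i 1) (i 2) := by
  constructor
  · intro h
    exact ⟨⟨h.1 (by decide), (h.lt_iff 1 0).2 (by decide)⟩,
      ⟨h.1 (by decide), (h.lt_iff 2 1).2 (by decide)⟩⟩
  · rintro ⟨⟨h1, h2⟩, h3, h4⟩
    exact isInstance_of_strictMono (strictMono_fin_three h1 h3) ![2, 1, 0] (by decide)
      (strictMono_fin_three h4 h2)

theorem num321_eq {n : ℕ} (w : Perm (Fin n)) : num321 w = (triples w).card := by
  have h : (triples w).card = Nat.card {x // x ∈ triples w} := by simp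
  rw [num321, h]
  refine Nat.card_congr ⟨fun i => ⟨(i.1 0, i.1 1, i.1 2), ?_⟩, fun x => ⟨![x.1.1, x.1.2.1, x.1.2.2],
    ?_⟩, ?_, ?_⟩
  · exact mem_triples.2 (isInstance_p321.1 i.2)
  · exact isInstance_p321.2 (mem_triples.1 x.2)
  · rintro ⟨i, hi⟩
    simp only [Subtype.mk.injEq]
    funext j
    fin_cases j <;> rfl
  · rintro ⟨⟨a, b, c⟩, h⟩
    rfl

theorem contains_four {n : ℕ} {w : Perm (Fin n)} {v : Fin 4 → ℕ}
    {hv : ∀ i, 1 ≤ v i ∧ v i ≤ 4} {hinj : Function.Injective v} {a b c d : Fin n}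
    (hab : a < b) (hbc : b < c) (hcd : c < d) (σ : Fin 4 → Fin 4)
    (hσ : ∀ j, v (σ j) = j.val + 1) (h0 : w (![a, b, c, d] (σ 0)) < w (![a, b, c, d] (σ 1)))
    (h1 : w (![a, b, c, d] (σ 1)) < w (![a, b, c, d] (σ 2)))
    (h2 : w (![a, b, c, d] (σ 2)) < w (![a, b, c, d] (σ 3))) :
    ContainsPattern w (oneLine v hv hinj) :=
  ⟨![a, b, c, d], isInstance_of_strictMono (strictMono_fin_four hab hbc hcd) σ hσ
    (strictMono_fin_four h0 h1 h2)⟩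

theorem contains_4321 {n : ℕ} {w : Perm (Fin n)} {a b c d : Fin n} (h : IsTriple w a b c)
    (h' : IsInv w c d) : ContainsPattern w p4321 :=
  contains_four h.1.1 h.2.1 h'.1 ![3, 2, 1, 0] (by decide) h'.2 h.2.2 h.1.2

theorem unique_iff_avoids {n : ℕ} (w : Perm (Fin n)) : (UniqueLast w ∧ UniqueFirst w) ↔
    (Avoids w p3421 ∧ Avoids w p4312 ∧ Avoids w p4321) := by
  constructor
  · rintro ⟨hl, hf⟩
    refine ⟨?_, ?_, ?_⟩
    · rintro ⟨i, hi⟩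
      have := hf (i 0) (i 1) (i 2) (i 3)
        ⟨⟨hi.1 (by decide), (hi.lt_iff 2 0).2 (by decide)⟩,
          hi.1 (by decide), (hi.lt_iff 3 2).2 (by decide)⟩
        ⟨⟨hi.1 (by decide), (hi.lt_iff 2 1).2 (by decide)⟩,
          hi.1 (by decide), (hi.lt_iff 3 2).2 (by decide)⟩
      exact absurd (hi.1.injective this) (by decide)
    · rintro ⟨i, hi⟩
      have := hl (i 0) (i 1) (i 2) (i 3)
        ⟨⟨hi.1 (by decide), (hi.lt_iff 1 0).2 (by decide)⟩,
          hi.1 (by decide), (hi.lt_iff 2 1).2 (by decide)⟩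
        ⟨⟨hi.1 (by decide), (hi.lt_iff 1 0).2 (by decide)⟩,
          hi.1 (by decide), (hi.lt_iff 3 1).2 (by decide)⟩
      exact absurd (hi.1.injective this) (by decide)
    · rintro ⟨i, hi⟩
      have := hl (i 0) (i 1) (i 2) (i 3)
        ⟨⟨hi.1 (by decide), (hi.lt_iff 1 0).2 (by decide)⟩,
          hi.1 (by decide), (hi.lt_iff 2 1).2 (by decide)⟩
        ⟨⟨hi.1 (by decide), (hi.lt_iff 1 0).2 (by decide)⟩,
          hi.1 (by decide), (hi.lt_iff 3 1).2 (by decide)⟩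
      exact absurd (hi.1.injective this) (by decide)
  · rintro ⟨h1, h2, h3⟩
    constructor
    · have key : ∀ i j k l, IsTriple w i j k → IsTriple w i j l → ¬ k < l := by
        intro i j k l t1 t2 hkl
        rcases lt_trichotomy (w k) (w l) with h | h | h
        · exact h2 (contains_four t1.1.1 t1.2.1 hkl ![2, 3, 1, 0] (by decide) h t2.2.2 t1.1.2)
        · exact hkl.ne (w.injective h)
        · exact h3 (contains_4321 t1 ⟨hkl, h⟩)
      intro i j k l t1 t2
      exact le_antisymm (not_lt.1 (key _ _ _ _ t2 t1)) (not_lt.1 (key _ _ _ _ t1 t2))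
    · have key : ∀ i j k l, IsTriple w i k l → IsTriple w j k l → ¬ i < j := by
        intro i j k l t1 t2 hij
        rcases lt_trichotomy (w i) (w j) with h | h | h
        · exact h1 (contains_four hij t2.1.1 t2.2.1 ![3, 2, 0, 1] (by decide) t1.2.2 t1.1.2 h)
        · exact hij.ne (w.injective h)
        · exact h3 (contains_4321 ⟨⟨hij, h⟩, t2.1⟩ t2.2)
      intro i j k l t1 t2
      exact le_antisymm (not_lt.1 (key _ _ _ _ t2 t1)) (not_lt.1 (key _ _ _ _ t1 t2))

theorem UniqueMid.avoids {n : ℕ} {w : Perm (Fin n)} (h : UniqueMid w) : Avoids w p4231 := by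
  rintro ⟨i, hi⟩
  have := h (i 0) (i 1) (i 2) (i 3)
    ⟨⟨hi.1 (by decide), (hi.lt_iff 1 0).2 (by decide)⟩,
      hi.1 (by decide), (hi.lt_iff 3 1).2 (by decide)⟩
    ⟨⟨hi.1 (by decide), (hi.lt_iff 2 0).2 (by decide)⟩,
      hi.1 (by decide), (hi.lt_iff 3 2).2 (by decide)⟩
  exact absurd (hi.1.injective this) (by decide)

theorem uniqueMid_of_avoids {n : ℕ} {w : Perm (Fin n)} (h1 : Avoids w p4231)
    (h2 : Avoids w p4321) : UniqueMid w := by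
  have key : ∀ i j k l, IsTriple w i j l → IsTriple w i k l → ¬ j < k := by
    intro i j k l t1 t2 hjk
    rcases lt_trichotomy (w j) (w k) with h | h | h
    · exact h1 (contains_four t1.1.1 hjk t2.2.1 ![3, 1, 2, 0] (by decide) t1.2.2 h t2.1.2)
    · exact hjk.ne (w.injective h)
    · exact h2 (contains_4321 ⟨t1.1, ⟨hjk, h⟩⟩ t2.2)
  intro i j k l t1 t2
  exact le_antisymm (not_lt.1 (key _ _ _ _ t2 t1)) (not_lt.1 (key _ _ _ _ t1 t2))

theorem maximallyClustered_iff {n : ℕ} (w : Perm (Fin n)) :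
    MaximallyClustered w ↔ UniqueLast w ∧ UniqueFirst w := by
  constructor
  · intro h
    have h1 := h.clustered.unique (num321_eq w).ge
    exact ⟨h1.1, h1.2.1⟩
  · rintro ⟨h1, h2⟩
    have := clustered_of_unique (P := fun _ => True) h1 h2 (Or.inl fun _ => trivial)
    rw [← num321_eq] at this
    exact this.maximallyClustered

theorem freelyBraided_iff {n : ℕ} (w : Perm (Fin n)) :
    FreelyBraided w ↔ (UniqueLast w ∧ UniqueFirst w) ∧ UniqueMid w := by
  constructor
  · intro h
    have h1 := h.clustered.unique (num321_eq w).ge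
    exact ⟨⟨h1.1, h1.2.1⟩, h1.2.2 fun _ => id⟩
  · rintro ⟨⟨h1, h2⟩, h3⟩
    have := clustered_of_unique (P := fun k => k ≤ 1) h1 h2 (Or.inr ⟨h3, fun _ => id⟩)
    rw [← num321_eq] at this
    exact this.freelyBraided

/-! ### Hexagonal configurations -/

/-- Eight positions at which the entries of `w` form one of the patterns `[46718235]`,
`[46781235]`, `[56718234]`, `[56781234]`. The entries are indexed in the order in which they
appear in `[46718235]`. -/
structure Hex {n : ℕ} (w : Perm (Fin n)) (p₁ p₂ p₃ p₄ p₅ p₆ p₇ p₈ : Fin n) : Prop where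
  h12 : p₁ < p₂
  h23 : p₂ < p₃
  h34 : p₃ < p₄
  h35 : p₃ < p₅
  h46 : p₄ < p₆
  h56 : p₅ < p₆
  h67 : p₆ < p₇
  h78 : p₇ < p₈
  v46 : w p₄ < w p₆
  v67 : w p₆ < w p₇
  v71 : w p₇ < w p₁
  v78 : w p₇ < w p₈
  v12 : w p₁ < w p₂
  v82 : w p₈ < w p₂
  v23 : w p₂ < w p₃
  v35 : w p₃ < w p₅

/-- `w` contains one of the four hexagonal patterns. -/
def HasHex {n : ℕ} (w : Perm (Fin n)) : Prop :=
  ∃ p₁ p₂ p₃ p₄ p₅ p₆ p₇ p₈, Hex w p₁ p₂ p₃ p₄ p₅ p₆ p₇ p₈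

theorem strictMono_fin_eight {α : Type*} [Preorder α] {f : Fin 8 → α} (h0 : f 0 < f 1)
    (h1 : f 1 < f 2) (h2 : f 2 < f 3) (h3 : f 3 < f 4) (h4 : f 4 < f 5) (h5 : f 5 < f 6)
    (h6 : f 6 < f 7) : StrictMono f := by
  rw [Fin.strictMono_iff_lt_succ]
  intro i
  fin_cases i <;> assumption

theorem hasHex_iff {n : ℕ} (w : Perm (Fin n)) : ¬ HasHex w ↔
    (Avoids w p46718235 ∧ Avoids w p46781235 ∧ Avoids w p56718234 ∧ Avoids w p56781234) := by
  constructor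
  · intro h
    refine ⟨?_, ?_, ?_, ?_⟩
    · rintro ⟨i, hi⟩
      refine h ⟨i 0, i 1, i 2, i 3, i 4, i 5, i 6, i 7, ?_⟩
      constructor <;> first | exact hi.1 (by decide) | exact (hi.lt_iff _ _).2 (by decide)
    · rintro ⟨i, hi⟩
      refine h ⟨i 0, i 1, i 2, i 4, i 3, i 5, i 6, i 7, ?_⟩
      constructor <;> first | exact hi.1 (by decide) | exact (hi.lt_iff _ _).2 (by decide)
    · rintro ⟨i, hi⟩
      refine h ⟨i 0, i 1, i 2, i 3, i 4, i 5, i 6, i 7, ?_⟩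
      constructor <;> first | exact hi.1 (by decide) | exact (hi.lt_iff _ _).2 (by decide)
    · rintro ⟨i, hi⟩
      refine h ⟨i 0, i 1, i 2, i 4, i 3, i 5, i 6, i 7, ?_⟩
      constructor <;> first | exact hi.1 (by decide) | exact (hi.lt_iff _ _).2 (by decide)
  · rintro ⟨h1, h2, h3, h4⟩ ⟨p₁, p₂, p₃, p₄, p₅, p₆, p₇, p₈, h⟩
    have v14 : w p₄ < w p₁ := h.v46.trans (h.v67.trans h.v71)
    rcases lt_or_gt_of_ne (fun e : p₄ = p₅ =>
        (h.v35.trans' (h.v23.trans' (h.v12.trans' v14))).ne (congrArg w e)) with hp | hp <;>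
      rcases lt_or_gt_of_ne (fun e : w p₁ = w p₈ => (h.h12.trans (h.h23.trans (h.h34.trans
        (h.h46.trans (h.h67.trans h.h78))))).ne (w.injective e)) with hv | hv
    · exact h1 ⟨![p₁, p₂, p₃, p₄, p₅, p₆, p₇, p₈], isInstance_of_strictMono
        (strictMono_fin_eight h.h12 h.h23 h.h34 hp h.h56 h.h67 h.h78) ![3, 5, 6, 0, 7, 1, 2, 4]
        (by decide) (strictMono_fin_eight h.v46 h.v67 h.v71 hv h.v82 h.v23 h.v35)⟩
    · exact h3 ⟨![p₁, p₂, p₃, p₄, p₅, p₆, p₇, p₈], isInstance_of_strictMono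
        (strictMono_fin_eight h.h12 h.h23 h.h34 hp h.h56 h.h67 h.h78) ![3, 5, 6, 7, 0, 1, 2, 4]
        (by decide) (strictMono_fin_eight h.v46 h.v67 h.v78 hv h.v12 h.v23 h.v35)⟩
    · exact h2 ⟨![p₁, p₂, p₃, p₅, p₄, p₆, p₇, p₈], isInstance_of_strictMono
        (strictMono_fin_eight h.h12 h.h23 h.h35 hp h.h46 h.h67 h.h78) ![4, 5, 6, 0, 7, 1, 2, 3]
        (by decide) (strictMono_fin_eight h.v46 h.v67 h.v71 hv h.v82 h.v23 h.v35)⟩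
    · exact h4 ⟨![p₁, p₂, p₃, p₅, p₄, p₆, p₇, p₈], isInstance_of_strictMono
        (strictMono_fin_eight h.h12 h.h23 h.h35 hp h.h46 h.h67 h.h78) ![4, 5, 6, 7, 0, 1, 2, 3]
        (by decide) (strictMono_fin_eight h.v46 h.v67 h.v78 hv h.v12 h.v23 h.v35)⟩

/-! ### Rearranging words along linear extensions of the heap -/

theorem prod_eq_of_pairwise {α G : Type*} [Monoid G] {f : α → G} {R : α → α → Prop}
    (hR : ∀ a b, R a b → ¬ R b a) {l₁ l₂ : List α} (hp : l₁.Perm l₂)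
    (h₁ : l₁.Pairwise fun a b => ¬ Commute (f a) (f b) → R a b)
    (h₂ : l₂.Pairwise fun a b => ¬ Commute (f a) (f b) → R a b) :
    (l₁.map f).prod = (l₂.map f).prod := by
  induction l₁ generalizing l₂ with
  | nil => rw [hp.nil_eq]
  | cons a t ih =>
    obtain ⟨p, q, rfl⟩ := List.append_of_mem (hp.subset List.mem_cons_self)
    have hpq : t.Perm (p ++ q) := (hp.trans List.perm_middle).cons_inv
    rw [List.pairwise_cons] at h₁
    have hcomm : ∀ b ∈ p, Commute (f a) (f b) := by
      intro b hb
      by_contra hc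
      have r1 := h₁.1 b (hpq.symm.subset (List.mem_append_left _ hb)) hc
      have r2 := (List.pairwise_append.1 h₂).2.2 b hb a List.mem_cons_self fun h => hc h.symm
      exact hR _ _ r1 r2
    have hc : Commute (f a) (p.map f).prod := by
      refine Commute.list_prod_right _ _ fun x hx => ?_
      obtain ⟨b, hb, rfl⟩ := List.mem_map.1 hx
      exact hcomm b hb
    have h₂' : (p ++ q).Pairwise fun a b => ¬ Commute (f a) (f b) → R a b :=
      h₂.sublist ((List.sublist_cons_self _ _).append_left _)
    rw [List.map_cons, List.prod_cons, ih hpq h₁.2 h₂']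
    simp only [List.map_append, List.prod_append, List.map_cons, List.prod_cons]
    rw [← mul_assoc, hc.eq, mul_assoc]

theorem heapLT.lt {n : ℕ} {x : Expr n} {i j : Fin x.length} (h : heapLT x i j) : i < j := by
  induction h with
  | single h => exact h.1
  | tail _ h ih => exact ih.trans h.1

theorem IsConvexSubheap.exists_factor {n : ℕ} {y x : Expr n} {g : Fin y.length → Fin x.length}
    (h : IsConvexSubheap y x g) : ∃ D U : Expr n,
      (D ++ (y ++ U)).length = x.length ∧ Expr.eval (D ++ (y ++ U) : Expr n) = Expr.eval x := by
  classical
  set below : Fin x.length → Prop := fun z => ∃ i, heapLT x z (g i) with hbelow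
  set D := (List.finRange x.length).filter fun z => z ∉ Set.range g ∧ below z with hD
  set U := (List.finRange x.length).filter fun z => z ∉ Set.range g ∧ ¬ below z with hU
  have memD : ∀ z, z ∈ D ↔ z ∉ Set.range g ∧ below z := by simp [hD]
  have memU : ∀ z, z ∈ U ↔ z ∉ Set.range g ∧ ¬ below z := by simp [hU]
  have memS : ∀ z, z ∈ List.ofFn g ↔ z ∈ Set.range g := by simp
  have hnd : (D ++ (List.ofFn g ++ U)).Nodup := by
    refine List.Nodup.append ((List.nodup_finRange _).filter _)
      (List.Nodup.append (List.nodup_ofFn.2 h.injective) ((List.nodup_finRange _).filter _) ?_) ?_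
    · intro z h1 h2
      exact ((memU z).1 h2).1 ((memS z).1 h1)
    · intro z h1 h2
      rcases List.mem_append.1 h2 with h2 | h2
      · exact ((memD z).1 h1).1 ((memS z).1 h2)
      · exact ((memU z).1 h2).2 ((memD z).1 h1).2
  have hperm : (List.finRange x.length).Perm (D ++ (List.ofFn g ++ U)) := by
    rw [List.perm_ext_iff_of_nodup (List.nodup_finRange _) hnd]
    intro z
    simp only [List.mem_finRange, List.mem_append, memD, memU, memS, true_iff]
    tauto
  have hsort : (List.finRange x.length).Pairwise (· < ·) := List.pairwise_lt_finRange _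
  have hlist : (D ++ (List.ofFn g ++ U)).map x.get = D.map x.get ++ (y ++ U.map x.get) := by
    rw [List.map_append, List.map_append, List.map_ofFn]
    congr 2
    rw [show x.get ∘ g = y.get from funext h.label, List.ofFn_get]
  refine ⟨D.map x.get, U.map x.get, ?_, ?_⟩
  · rw [← hlist, List.length_map, ← hperm.length_eq, List.length_finRange]
  · rw [← hlist]
    conv_rhs => rw [← List.map_get_finRange x]
    simp only [Expr.eval, List.map_map]
    have hS : ∀ l : List (Fin x.length), l.Pairwise (· < ·) → l.Pairwise fun a b =>
        ¬ Commute ((gen ∘ x.get) a : Perm (Fin n)) ((gen ∘ x.get) b) → a < b := by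
      intro l hl
      refine hl.imp ?_
      intro a b hab _
      exact hab
    refine (prod_eq_of_pairwise (G := Perm (Fin n)) (f := gen ∘ x.get) (R := (· < ·)) (fun a b => lt_asymm) hperm
      (hS _ hsort) ?_).symm
    have step : ∀ a b : Fin x.length, a ≠ b →
        ¬ Commute ((gen ∘ x.get) a : Perm (Fin n)) ((gen ∘ x.get) b) →
        ¬ a < b → heapLT x b a := fun a b hab hc hlt =>
      .single ⟨lt_of_le_of_ne (not_lt.1 hlt) hab.symm, fun h => hc h.symm⟩
    rw [List.pairwise_append, List.pairwise_append]
    refine ⟨hS _ (hsort.filter _), ⟨?_, hS _ (hsort.filter _), ?_⟩, ?_⟩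
    · rw [List.pairwise_ofFn]
      intro i j hij hc
      have : heapLT y i j := .single ⟨hij, by
        rw [← h.label, ← h.label]
        exact hc⟩
      exact ((h.order_iff i j).2 this).lt
    · intro s hs u hu hc
      by_contra hlt
      obtain ⟨i, rfl⟩ := (memS s).1 hs
      obtain ⟨hu1, hu2⟩ := (memU u).1 hu
      exact hu2 ⟨i, step _ _ (fun e => hu1 ⟨i, e⟩) hc hlt⟩
    · intro d hd b hb hc
      by_contra hlt
      obtain ⟨hd1, i, hi⟩ := (memD d).1 hd
      rcases List.mem_append.1 hb with hb | hb
      · obtain ⟨j, rfl⟩ := (memS b).1 hb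
        exact hd1 (h.convex j i d (step _ _ (fun e => hd1 ⟨j, e.symm⟩) hc hlt) hi)
      · obtain ⟨hb1, hb2⟩ := (memU b).1 hb
        exact hb2 ⟨i, (step _ _ (fun e : d = b => hb2 ⟨i, e ▸ hi⟩) hc hlt).trans hi⟩

theorem isConvexSubheap_append {n : ℕ} (D y U : Expr n) :
    ∃ g, IsConvexSubheap y (D ++ (y ++ U)) g := by
  have hg : ∀ i : Fin y.length, D.length + i.val < (D ++ (y ++ U)).length := by
    intro i
    simp only [List.length_append]
    omega
  have hlab : ∀ i : Fin y.length, (D ++ (y ++ U)).get ⟨D.length + i.val, hg i⟩ = y.get i := by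
    intro i
    simp only [List.get_eq_getElem]
    rw [List.getElem_append_right (by omega), List.getElem_append_left (by omega)]
    simp
  have hmem : ∀ (i j : Fin y.length) (z : Fin (D ++ (y ++ U)).length),
      (⟨D.length + i.val, hg i⟩ : Fin (D ++ (y ++ U)).length) < z →
      z < ⟨D.length + j.val, hg j⟩ →
      ∃ k : Fin y.length, (⟨D.length + k.val, hg k⟩ : Fin (D ++ (y ++ U)).length) = z := by
    intro i j z h1 h2
    simp only [Fin.lt_def] at h1 h2
    refine ⟨⟨z.val - D.length, by omega⟩, ?_⟩
    ext
    simp only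
    omega
  refine ⟨fun i => ⟨D.length + i.val, hg i⟩, ⟨?_, hlab, ?_, ?_⟩⟩
  · intro i j hij
    simp only [Fin.mk.injEq] at hij
    ext
    omega
  · intro i j
    constructor
    · intro h
      generalize hb : (⟨D.length + j.val, hg j⟩ : Fin (D ++ (y ++ U)).length) = b at h
      induction h generalizing j with
      | single h =>
        subst hb
        refine .single ⟨?_, ?_⟩
        · have := h.1
          simp only [Fin.lt_def] at this ⊢
          omega
        · rw [← hlab i, ← hlab j]
          exact h.2
      | @tail c d h1 h2 ih =>
        subst hb
        obtain ⟨k, rfl⟩ := hmem i j c (heapLT.lt h1) h2.1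
        refine (ih k rfl).tail ⟨?_, ?_⟩
        · have := h2.1
          simp only [Fin.lt_def] at this ⊢
          omega
        · rw [← hlab k, ← hlab j]
          exact h2.2
    · intro h
      refine Relation.TransGen.lift (fun i : Fin y.length =>
        (⟨D.length + i.val, hg i⟩ : Fin (D ++ (y ++ U)).length)) ?_ i j h
      rintro a b ⟨h1, h2⟩
      refine ⟨?_, ?_⟩
      · simp only [Fin.lt_def] at h1 ⊢
        omega
      · rw [hlab, hlab]
        exact h2
  · intro i j z h1 h2
    obtain ⟨k, hk⟩ := hmem i j z h1.lt h2.lt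
    exact ⟨k, hk⟩

theorem heapContains_iff {n k : ℕ} (w : Perm (Fin n)) (h : Perm (Fin k)) : HeapContains w h ↔
    ∃ (D U : Expr n) (y : Expr k) (f : Fin (k - 1) → Fin (n - 1)),
      IsReducedExpr (D ++ (y.map f ++ U) : Expr n) w ∧ IsReducedExpr y h ∧
        IsCoxeterEmbedding f := by
  constructor
  · rintro ⟨x, y, f, ⟨rfl, hx⟩, hy, hf, g, hg⟩
    obtain ⟨D, U, h1, h2⟩ := hg.exists_factor
    refine ⟨D, U, y, f, ⟨h2, ?_⟩, hy, hf⟩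
    rw [isReduced_iff] at hx ⊢
    rw [h2, h1, hx]
  · rintro ⟨D, U, y, f, hx, hy, hf⟩
    exact ⟨_, y, f, hx, hy, hf, isConvexSubheap_append D (y.map f) U⟩

/-! ### Embeddings of the Coxeter graph -/

theorem gen_mul_gen_sq_ne {n : ℕ} {i j : Fin (n - 1)} (h : i.val + 1 = j.val) :
    (gen i * gen j : Perm (Fin n)) ^ 2 ≠ 1 := by
  intro he
  have h1 := DFunLike.congr_fun he (lo i)
  have hne : ∀ a b : Fin n, a.val ≠ b.val → a ≠ b := fun a b h e => h (congrArg Fin.val e)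
  have e1 : gen j (lo i) = lo i :=
    Equiv.swap_apply_of_ne_of_ne (hne _ _ (by simp only [lo]; omega))
      (hne _ _ (by simp only [lo]; omega))
  have e2 : gen i (lo i) = lo j := (Equiv.swap_apply_left _ _).trans (Fin.ext h)
  have e3 : gen j (lo j) = hi j := Equiv.swap_apply_left _ _
  have e4 : gen i (hi j) = hi j :=
    Equiv.swap_apply_of_ne_of_ne (hne _ _ (by simp only [hi]; omega))
      (hne _ _ (by simp only [hi]; omega))
  rw [pow_two] at h1
  simp only [Perm.mul_apply, e1, e2, e3, e4, Perm.one_apply] at h1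
  have := congrArg Fin.val h1
  simp only [hi, lo] at this
  omega

theorem gen_mul_gen_sq {n : ℕ} {i j : Fin (n - 1)} (hij : i.val + 1 < j.val) :
    (gen i * gen j : Perm (Fin n)) ^ 2 = 1 := by
  have hd : Commute (gen i : Perm (Fin n)) (gen j) := by
    apply Equiv.Perm.Disjoint.commute
    apply Equiv.Perm.disjoint_swap_swap
    simp [Fin.ext_iff]
    omega
  rw [hd.mul_pow, pow_two, pow_two, gen_mul_gen, gen_mul_gen, one_mul]

theorem IsCoxeterEmbedding.succ {k n : ℕ} {f : Fin (k - 1) → Fin (n - 1)}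
    (h : IsCoxeterEmbedding f) {i j : Fin (k - 1)} (hij : i.val + 1 = j.val) :
    (f j).val = (f i).val + 1 := by
  have h1 : (f i).val < (f j).val := h.orientation i j (by simp only [Fin.lt_def]; omega)
  by_contra hne
  exact gen_mul_gen_sq_ne hij ((h.order_iff 2 (Or.inl rfl) i j).2 (gen_mul_gen_sq (by omega)))

theorem IsCoxeterEmbedding.shift {k n : ℕ} {f : Fin (k - 1) → Fin (n - 1)}
    (h : IsCoxeterEmbedding f) (hk : 0 < k - 1) (i : Fin (k - 1)) :
    (f i).val = (f ⟨0, hk⟩).val + i.val := by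
  obtain ⟨i, hi⟩ := i
  induction i with
  | zero => rfl
  | succ i ih =>
    rw [h.succ (i := ⟨i, by omega⟩) rfl, ih]
    simp [add_assoc]

/-- The inclusion of `k` consecutive points, starting at `c`. -/
def shiftEmb {k n : ℕ} (c : ℕ) (h : c + k ≤ n) : Fin k ↪ Fin n where
  toFun j := ⟨c + j.val, by omega⟩
  inj' i j hij := by
    simp only [Fin.mk.injEq] at hij
    ext
    omega

theorem val_shiftEmb {k n c : ℕ} (h : c + k ≤ n) (j : Fin k) :
    (shiftEmb c h j).val = c + j.val := rfl

theorem gen_shift {k n c : ℕ} (h : c + k ≤ n) {i : Fin (k - 1)} {j : Fin (n - 1)}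
    (hj : j.val = c + i.val) :
    (gen j : Perm (Fin n)) = Equiv.Perm.viaEmbeddingHom (shiftEmb c h) (gen i) := by
  have e1 : lo j = shiftEmb c h (lo i) := by
    ext
    simp [lo, val_shiftEmb, hj]
  have e2 : hi j = shiftEmb c h (hi i) := by
    ext
    simp [hi, val_shiftEmb, hj, add_assoc]
  ext x
  rw [Equiv.Perm.viaEmbeddingHom_apply, gen_eq, gen_eq, e1, e2]
  by_cases hx : x ∈ Set.range (shiftEmb c h)
  · obtain ⟨y, rfl⟩ := hx
    rw [Equiv.Perm.viaEmbedding_apply, (shiftEmb c h).injective.swap_apply]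
  · rw [Equiv.Perm.viaEmbedding_apply_of_notMem _ _ _ hx, Equiv.swap_apply_of_ne_of_ne]
    · rintro rfl
      exact hx ⟨_, rfl⟩
    · rintro rfl
      exact hx ⟨_, rfl⟩

theorem eval_map_shift {k n c : ℕ} (h : c + k ≤ n) {f : Fin (k - 1) → Fin (n - 1)}
    (hf : ∀ i, (f i).val = c + i.val) (y : Expr k) : Expr.eval (y.map f : Expr n) =
      Equiv.Perm.viaEmbeddingHom (shiftEmb c h) (Expr.eval y) := by
  induction y with
  | nil => simp [Expr.eval]
  | cons i y ih => rw [List.map_cons, eval_cons, ih, gen_shift h (hf i), eval_cons, map_mul]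

theorem isCoxeterEmbedding_of_shift {k n c : ℕ} (h : c + k ≤ n) {f : Fin (k - 1) → Fin (n - 1)}
    (hf : ∀ i, (f i).val = c + i.val) : IsCoxeterEmbedding f where
  injective i j hij := by
    have h1 := hf i
    have h2 := hf j
    rw [hij] at h1
    ext
    omega
  order_iff m _ i j := by
    rw [gen_shift h (hf i), gen_shift h (hf j), ← map_mul, ← map_pow,
      map_eq_one_iff _ (Equiv.Perm.viaEmbeddingHom_injective _)]
  orientation i j hij := by
    have h1 := hf i
    have h2 := hf j
    simp only [Fin.lt_def] at hij ⊢
    omega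

theorem shiftEmb_lt {k n c : ℕ} (h : c + k ≤ n) (i j : Fin k) :
    shiftEmb c h i < shiftEmb c h j ↔ i < j := by
  rw [Fin.lt_def, Fin.lt_def, val_shiftEmb, val_shiftEmb, Nat.add_lt_add_iff_left]

theorem isInv_viaEmbedding {k n c : ℕ} (h : c + k ≤ n) {u : Perm (Fin k)} {i j : Fin k}
    (hij : IsInv u i j) :
    IsInv (Equiv.Perm.viaEmbeddingHom (shiftEmb c h) u) (shiftEmb c h i) (shiftEmb c h j) := by
  constructor
  · rw [shiftEmb_lt]
    exact hij.1
  · rw [Equiv.Perm.viaEmbeddingHom_apply, Equiv.Perm.viaEmbedding_apply,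
      Equiv.Perm.viaEmbedding_apply, shiftEmb_lt]
    exact hij.2

theorem IsReduced.map_shift {k n c : ℕ} (h : c + k ≤ n) {f : Fin (k - 1) → Fin (n - 1)}
    (hf : ∀ i, (f i).val = c + i.val) {y : Expr k} (hy : IsReduced y) :
    IsReduced (y.map f : Expr n) := by
  rw [isReduced_iff] at hy ⊢
  refine le_antisymm (len_eval_le _) ?_
  rw [List.length_map, ← hy, eval_map_shift h hf]
  refine Finset.card_le_card_of_injOn (fun x => (shiftEmb c h x.1, shiftEmb c h x.2)) ?_ ?_
  · intro x hx
    exact mem_invs.2 (isInv_viaEmbedding h (mem_invs.1 hx))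
  · rintro ⟨a, b⟩ - ⟨a', b'⟩ - hab
    simpa using hab

/-! ### Heap containment gives a hexagonal pattern -/

theorem UniqueLast.not_isInv {n : ℕ} {w : Perm (Fin n)} (h : UniqueLast w) {a b k l : Fin n}
    (hkl : k ≠ l) (hk : IsInv w b k) (hl : IsInv w b l) : ¬ IsInv w a b :=
  fun hab => hkl (h _ _ _ _ ⟨hab, hk⟩ ⟨hab, hl⟩)

theorem UniqueFirst.not_isInv {n : ℕ} {w : Perm (Fin n)} (h : UniqueFirst w) {a b k l : Fin n}
    (hkl : k ≠ l) (hk : IsInv w k a) (hl : IsInv w l a) : ¬ IsInv w a b :=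
  fun hab => hkl (h _ _ _ _ ⟨hk, hab⟩ ⟨hl, hab⟩)

theorem hasHex_of_heapContains {n : ℕ} {w : Perm (Fin n)} (hl : UniqueLast w)
    (hf : UniqueFirst w) (h : HeapContains w p46718235) : HasHex w := by
  obtain ⟨D, U, y, f, ⟨hw, hr⟩, ⟨hy, -⟩, hfe⟩ := (heapContains_iff _ _).1 h
  have hsh := hfe.shift (by norm_num)
  set c := (f ⟨0, by norm_num⟩).val with hc
  have hcn : c + 8 ≤ n := by
    have h1 := hsh ⟨6, by norm_num⟩
    have h2 := (f ⟨6, by norm_num⟩).isLt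
    simp only at h1
    omega
  have hφ := eval_map_shift hcn hsh y
  rw [hy] at hφ
  set z := Expr.eval U with hz
  set e : Fin 8 → Fin n := fun j => z⁻¹ (shiftEmb c hcn j) with he
  have hr' := hr.of_append
  have einj : Function.Injective e := z⁻¹.injective.comp (shiftEmb c hcn).injective
  have hA : ∀ i j, IsInv p46718235 i j → IsInv w (e i) (e j) := by
    intro i j hij
    have h1 := isInv_viaEmbedding hcn hij
    rw [← hφ] at h1
    have h2 := hr'.1.lt_of_isInv h1
    have h3 := hr'.2 (e i) (e j) ⟨h2, by
      rw [eval_append]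
      simpa [he, ← hz] using h1.2⟩
    rwa [hw] at h3
  have hB : ∀ i j, i < j → e j < e i → IsInv w (e j) (e i) := by
    intro i j hij hlt
    have h1 : IsInv z (e j) (e i) := ⟨hlt, by
      simp only [he, apply_inv]
      exact (shiftEmb_lt hcn i j).2 hij⟩
    have h2 := hr'.2 _ _ (hr'.1.of_append.2 _ _ h1)
    rwa [hw] at h2
  have hC : ∀ i j, i < j → ¬ IsInv w (e i) (e j) → ¬ IsInv w (e j) (e i) →
      e i < e j ∧ w (e i) < w (e j) := by
    intro i j hij h1 h2
    have hne : e i ≠ e j := fun h => hij.ne (einj h)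
    have h3 : e i < e j := lt_of_le_of_ne (not_lt.1 fun h => h2 (hB i j hij h)) hne
    exact ⟨h3, lt_of_le_of_ne (not_lt.1 fun h => h1 ⟨h3, h⟩) fun h => hne (w.injective h)⟩
  have hinv : ∀ i j : Fin 8, i < j → (![4, 6, 7, 1, 8, 2, 3, 5] : Fin 8 → ℕ) j <
      (![4, 6, 7, 1, 8, 2, 3, 5] : Fin 8 → ℕ) i → IsInv w (e i) (e j) := fun i j h1 h2 =>
    hA i j ⟨h1, oneLine_lt _ _ |>.2 h2⟩
  have up : ∀ i j k l : Fin 8, i < j → k ≠ l → IsInv w (e i) (e k) → IsInv w (e i) (e l) →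
      IsInv w (e j) (e k) → IsInv w (e j) (e l) → e i < e j ∧ w (e i) < w (e j) :=
    fun i j k l hij hkl h1 h2 h3 h4 => hC i j hij (hl.not_isInv (einj.ne hkl) h3 h4)
      (hl.not_isInv (einj.ne hkl) h1 h2)
  have down : ∀ i j k l : Fin 8, i < j → k ≠ l → IsInv w (e k) (e i) → IsInv w (e l) (e i) →
      IsInv w (e k) (e j) → IsInv w (e l) (e j) → e i < e j ∧ w (e i) < w (e j) :=
    fun i j k l hij hkl h1 h2 h3 h4 => hC i j hij (hf.not_isInv (einj.ne hkl) h1 h2)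
      (hf.not_isInv (einj.ne hkl) h3 h4)
  have i03 := hinv 0 3 (by decide) (by decide)
  have i05 := hinv 0 5 (by decide) (by decide)
  have i06 := hinv 0 6 (by decide) (by decide)
  have i13 := hinv 1 3 (by decide) (by decide)
  have i15 := hinv 1 5 (by decide) (by decide)
  have i16 := hinv 1 6 (by decide) (by decide)
  have i17 := hinv 1 7 (by decide) (by decide)
  have i23 := hinv 2 3 (by decide) (by decide)
  have i25 := hinv 2 5 (by decide) (by decide)
  have i26 := hinv 2 6 (by decide) (by decide)
  have i27 := hinv 2 7 (by decide) (by decide)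
  have i45 := hinv 4 5 (by decide) (by decide)
  have i46 := hinv 4 6 (by decide) (by decide)
  have u01 := up 0 1 3 5 (by decide) (by decide) i03 i05 i13 i15
  have u12 := up 1 2 3 5 (by decide) (by decide) i13 i15 i23 i25
  have u24 := up 2 4 5 6 (by decide) (by decide) i25 i26 i45 i46
  have d35 := down 3 5 0 1 (by decide) (by decide) i03 i13 i05 i15
  have d56 := down 5 6 0 1 (by decide) (by decide) i05 i15 i06 i16
  have d67 := down 6 7 1 2 (by decide) (by decide) i16 i26 i17 i27
  exact ⟨e 0, e 1, e 2, e 3, e 4, e 5, e 6, e 7, u01.1, u12.1, i23.1, u24.1, d35.1, i45.1, d56.1,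
    d67.1, d35.2, d56.2, i06.2, d67.2, u01.2, i17.2, u12.2, u24.2⟩

/-! ### Symmetry under inversion -/

theorem isInv_inv {n : ℕ} {w : Perm (Fin n)} {i j : Fin n} (h : IsInv w⁻¹ i j) :
    IsInv w (w⁻¹ j) (w⁻¹ i) :=
  ⟨h.2, by rw [apply_inv, apply_inv]; exact h.1⟩

theorem isTriple_inv {n : ℕ} {w : Perm (Fin n)} {i j k : Fin n} (h : IsTriple w⁻¹ i j k) :
    IsTriple w (w⁻¹ k) (w⁻¹ j) (w⁻¹ i) :=
  ⟨isInv_inv h.2, isInv_inv h.1⟩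

theorem UniqueLast.inv {n : ℕ} {w : Perm (Fin n)} (h : UniqueLast w) : UniqueFirst w⁻¹ :=
  fun _ _ _ _ h1 h2 => w⁻¹.injective (h _ _ _ _ (isTriple_inv h1) (isTriple_inv h2))

theorem UniqueFirst.inv {n : ℕ} {w : Perm (Fin n)} (h : UniqueFirst w) : UniqueLast w⁻¹ :=
  fun _ _ _ _ h1 h2 => w⁻¹.injective (h _ _ _ _ (isTriple_inv h1) (isTriple_inv h2))

theorem len_inv {n : ℕ} (w : Perm (Fin n)) : len w⁻¹ = len w := by
  have key : ∀ u : Perm (Fin n), len u⁻¹ ≤ len u := by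
    intro u
    obtain ⟨x, rfl, hx⟩ := exists_expr u
    rw [← eval_reverse, ← hx, ← List.length_reverse]
    exact len_eval_le _
  exact le_antisymm (key w) (by simpa using key w⁻¹)

theorem Hex.inv {n : ℕ} {w : Perm (Fin n)} {p₁ p₂ p₃ p₄ p₅ p₆ p₇ p₈ : Fin n}
    (h : Hex w p₁ p₂ p₃ p₄ p₅ p₆ p₇ p₈) :
    Hex w⁻¹ (w p₄) (w p₆) (w p₇) (w p₁) (w p₈) (w p₂) (w p₃) (w p₅) := by
  obtain ⟨h1, h2, h3, h4, h5, h6, h7, h8, h9, h10, h11, h12, h13, h14, h15, h16⟩ := h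
  constructor <;> (try simp only [inv_apply]) <;> assumption

theorem HasHex.inv {n : ℕ} {w : Perm (Fin n)} (h : HasHex w) : HasHex w⁻¹ := by
  obtain ⟨p₁, p₂, p₃, p₄, p₅, p₆, p₇, p₈, h⟩ := h
  exact ⟨_, _, _, _, _, _, _, _, h.inv⟩

theorem unique_gen_mul {n : ℕ} {w : Perm (Fin n)} (hl : UniqueLast w) (hf : UniqueFirst w)
    {k : Fin (n - 1)} (hk : w⁻¹ (hi k) < w⁻¹ (lo k)) :
    UniqueLast (gen k * w) ∧ UniqueFirst (gen k * w) := by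
  have ha : (gen k * w)⁻¹ (lo k) < (gen k * w)⁻¹ (hi k) := by
    simpa [gen_inv, gen_eq, Perm.mul_apply] using hk
  have hb := isBlock_of_ascent ha
  have hm : ∀ {a b c}, IsTriple (gen k * w) a b c → IsTriple w a b c := by
    intro a b c h
    have := hb.isTriple_mono h
    rwa [← gen_mul_eq, ← mul_assoc, gen_mul_gen, one_mul] at this
  exact ⟨fun _ _ _ _ h1 h2 => hl _ _ _ _ (hm h1) (hm h2),
    fun _ _ _ _ h1 h2 => hf _ _ _ _ (hm h1) (hm h2)⟩

/-! ### Permutations in which no descent can be removed -/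

/-- Removing any descent of `w` or of its inverse destroys all hexagonal patterns. -/
structure MinHex {n : ℕ} (w : Perm (Fin n)) : Prop where
  last : UniqueLast w
  first : UniqueFirst w
  right : ∀ k : Fin (n - 1), w (hi k) < w (lo k) → ¬ HasHex (w * gen k)
  left : ∀ k : Fin (n - 1), w⁻¹ (hi k) < w⁻¹ (lo k) → ¬ HasHex (w⁻¹ * gen k)

theorem MinHex.inv {n : ℕ} {w : Perm (Fin n)} (h : MinHex w) : MinHex w⁻¹ :=
  ⟨h.first.inv, h.last.inv, h.left, by rw [inv_inv]; exact h.right⟩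

theorem gen_lt_gen {n : ℕ} {k : Fin (n - 1)} {a b : Fin n} (hab : a < b)
    (h : ¬ (a = lo k ∧ b = hi k)) : gen k a < gen k b := by
  simp only [gen_eq, Equiv.swap_apply_def]
  simp only [lo, hi, Fin.ext_iff, Fin.lt_def] at *
  split_ifs <;> (try simp only) <;> omega

theorem MinHex.descent {n : ℕ} {w : Perm (Fin n)} (hw : MinHex w)
    {p₁ p₂ p₃ p₄ p₅ p₆ p₇ p₈ : Fin n} (h : Hex w p₁ p₂ p₃ p₄ p₅ p₆ p₇ p₈) {k : Fin (n - 1)}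
    (hk : w (hi k) < w (lo k)) : (p₃ = lo k ∧ p₄ = hi k) ∨ (p₅ = lo k ∧ p₆ = hi k) := by
  by_contra hcon
  push Not at hcon
  have hne : ∀ a b, w a < w b → ¬ (a = lo k ∧ b = hi k) := by
    rintro a b hab ⟨rfl, rfl⟩
    exact lt_asymm hab hk
  have e : ∀ a, (w * gen k) (gen k a) = w a := by
    intro a
    rw [← Perm.mul_apply, mul_assoc, gen_mul_gen, mul_one]
  refine hw.right k hk ⟨gen k p₁, gen k p₂, gen k p₃, gen k p₄, gen k p₅, gen k p₆, gen k p₇,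
    gen k p₈, ?_⟩
  constructor <;> try simp only [e]
  · exact gen_lt_gen h.h12 (hne _ _ h.v12)
  · exact gen_lt_gen h.h23 (hne _ _ h.v23)
  · exact gen_lt_gen h.h34 fun h => hcon.1 h.1 h.2
  · exact gen_lt_gen h.h35 (hne _ _ h.v35)
  · exact gen_lt_gen h.h46 (hne _ _ h.v46)
  · exact gen_lt_gen h.h56 fun h => hcon.2 h.1 h.2
  · exact gen_lt_gen h.h67 (hne _ _ h.v67)
  · exact gen_lt_gen h.h78 (hne _ _ h.v78)
  · exact h.v46
  · exact h.v67
  · exact h.v71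
  · exact h.v78
  · exact h.v12
  · exact h.v82
  · exact h.v23
  · exact h.v35

/-- The consequences of minimality for the positions of a hexagonal pattern. -/
structure MinHexPos {n : ℕ} (w : Perm (Fin n)) (p₃ p₄ p₅ p₆ : Fin n) : Prop where
  h45 : p₄ < p₅
  h34 : p₃.val + 1 = p₄.val
  h56 : p₅.val + 1 = p₆.val
  mono_left : ∀ a b, a < b → b ≤ p₃ → w a < w b
  mono_mid : ∀ a b, p₄ ≤ a → a < b → b ≤ p₅ → w a < w b
  mono_right : ∀ a b, p₆ ≤ a → a < b → w a < w b

theorem MinHex.pos {n : ℕ} {w : Perm (Fin n)} (hw : MinHex w)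
    {p₁ p₂ p₃ p₄ p₅ p₆ p₇ p₈ : Fin n} (h : Hex w p₁ p₂ p₃ p₄ p₅ p₆ p₇ p₈) :
    MinHexPos w p₃ p₄ p₅ p₆ := by
  have d : ∀ a b, a < b → ¬ w a < w b → ∃ k : Fin (n - 1), a ≤ lo k ∧ hi k ≤ b ∧
      ((p₃ = lo k ∧ p₄ = hi k) ∨ (p₅ = lo k ∧ p₆ = hi k)) := by
    intro a b hab hn
    obtain ⟨k, h1, h2, h3⟩ := exists_descent (w := w)
      ⟨hab, lt_of_le_of_ne (not_lt.1 hn) fun e => hab.ne' (w.injective e)⟩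
    exact ⟨k, h1, h2, hw.descent h h3⟩
  obtain ⟨h12, h23, h34, h35, h46, h56, h67, h78, v46, v67, v71, v78, v12, v82, v23, v35⟩ := h
  have h45 : p₄ < p₅ := by
    by_contra hcon
    have hne : p₅ ≠ p₄ := by
      rintro rfl
      order
    obtain ⟨k, h1, h2, h3⟩ := d p₅ p₄ (by order) (by order)
    rcases h3 with ⟨h3, h4⟩ | ⟨h3, h4⟩ <;> order
  refine ⟨h45, ?_, ?_, ?_, ?_, ?_⟩
  · obtain ⟨k, h1, h2, h3⟩ := d p₃ p₄ (by order) (by order)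
    rcases h3 with ⟨rfl, rfl⟩ | ⟨h3, h4⟩
    · rfl
    · order
  · obtain ⟨k, h1, h2, h3⟩ := d p₅ p₆ (by order) (by order)
    rcases h3 with ⟨h3, h4⟩ | ⟨rfl, rfl⟩
    · order
    · rfl
  · intro a b hab hb
    by_contra hcon
    obtain ⟨k, h1, h2, h3⟩ := d a b hab hcon
    rcases h3 with ⟨h3, h4⟩ | ⟨h3, h4⟩ <;> order
  · intro a b ha hab hb
    by_contra hcon
    obtain ⟨k, h1, h2, h3⟩ := d a b hab hcon
    rcases h3 with ⟨h3, h4⟩ | ⟨h3, h4⟩ <;> order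
  · intro a b ha hab
    by_contra hcon
    obtain ⟨k, h1, h2, h3⟩ := d a b hab hcon
    have := lo_lt_hi k
    rcases h3 with ⟨h3, h4⟩ | ⟨h3, h4⟩ <;> order

theorem val_succ_of_no_between {n : ℕ} {a b : Fin n} (hab : a < b)
    (h : ∀ x, a < x → x < b → False) : b.val = a.val + 1 := by
  by_contra hne
  have h1 : a.val < b.val := hab
  exact h ⟨a.val + 1, by omega⟩ (by simp [Fin.lt_def]) (by simp only [Fin.lt_def]; omega)

theorem MinHex.consecutive {n : ℕ} {w : Perm (Fin n)} (hw : MinHex w)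
    {p₁ p₂ p₃ p₄ p₅ p₆ p₇ p₈ : Fin n} (h : Hex w p₁ p₂ p₃ p₄ p₅ p₆ p₇ p₈) :
    p₂.val = p₁.val + 1 ∧ p₃.val = p₁.val + 2 ∧ p₄.val = p₁.val + 3 ∧ p₅.val = p₁.val + 4 ∧
      p₆.val = p₁.val + 5 ∧ p₇.val = p₁.val + 6 ∧ p₈.val = p₁.val + 7 := by
  have hp := hw.pos h
  have hq := hw.inv.pos h.inv
  have hP : ∀ q₁ q₂ q₃ q₄ q₅ q₆ q₇ q₈, Hex w q₁ q₂ q₃ q₄ q₅ q₆ q₇ q₈ →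
      q₃.val + 1 = q₄.val ∧ q₅.val + 1 = q₆.val ∧ (w q₇).val + 1 = (w q₁).val ∧
        (w q₈).val + 1 = (w q₂).val := fun _ _ _ _ _ _ _ _ hh =>
    ⟨(hw.pos hh).h34, (hw.pos hh).h56, (hw.inv.pos hh.inv).h34, (hw.inv.pos hh.inv).h56⟩
  have huniq := hw.last
  obtain ⟨a45, a34, a56, al, am, ar⟩ := hp
  obtain ⟨b45, b34, b56, bl, bm, br⟩ := hq
  have bl' : ∀ x y, w x < w y → w y ≤ w p₇ → x < y := fun x y h1 h2 => by
    simpa only [inv_apply] using bl _ _ h1 h2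
  have br' : ∀ x y, w p₂ ≤ w x → w x < w y → x < y := fun x y h1 h2 => by
    simpa only [inv_apply] using br _ _ h1 h2
  have hne : ∀ x y, x < y → w x ≠ w y := fun x y hxy e => hxy.ne (w.injective e)
  have hadj : ∀ a b c : Fin n, a.val + 1 = b.val → a < c → c ≠ b → b < c := by
    intro a b c h1 h2 h3
    simp only [Fin.lt_def, ne_eq, Fin.ext_iff] at *
    omega
  have hadj' : ∀ a b c : Fin n, a.val + 1 = b.val → c < b → c ≠ a → c < a := by
    intro a b c h1 h2 h3
    simp only [Fin.lt_def, ne_eq, Fin.ext_iff] at *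
    omega
  have hdup : ∀ a b c : Fin n, a.val + 1 = b.val → a.val + 1 = c.val → b = c := by
    intro a b c h1 h2
    ext
    omega
  have hdup' : ∀ a b c : Fin n, b.val + 1 = a.val → c.val + 1 = a.val → b = c := by
    intro a b c h1 h2
    ext
    omega
  obtain ⟨h12, h23, h34, h35, h46, h56, h67, h78, v46, v67, v71, v78, v12, v82, v23, v35⟩ := h
  have g12 := val_succ_of_no_between h12 fun x x1 x2 => by
    have y1 : w p₁ < w x := al _ _ x1 (by order)
    have y2 : w x < w p₂ := al _ _ x2 (by order)
    have := (hP x p₂ p₃ p₄ p₅ p₆ p₇ p₈ ⟨x2, h23, h34, h35, h46, h56, h67, h78, v46, v67,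
      by order, v78, y2, v82, v23, v35⟩).2.2.1
    exact hne _ _ x1 (hdup _ _ _ b34 this)
  have g23 := val_succ_of_no_between h23 fun x x1 x2 => by
    have y1 : w p₂ < w x := al _ _ x1 (by order)
    have y2 : w x < w p₃ := al _ _ x2 (by order)
    have := (hP p₁ p₂ x p₄ p₅ p₆ p₇ p₈ ⟨h12, x1, by order, by order, h46, h56, h67, h78, v46, v67,
      v71, v78, v12, v82, y1, by order⟩).1
    exact x2.ne (hdup' _ _ _ this a34)
  have g45 := val_succ_of_no_between a45 fun x x1 x2 => by
    have y1 : w p₄ < w x := am _ _ le_rfl x1 x2.le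
    have y2 : w x < w p₅ := am _ _ x1.le x2 le_rfl
    rcases lt_trichotomy (w x) (w p₁) with z | z | z
    · have z1 : w x < w p₇ := hadj' _ _ _ b34 z (hne _ _ (by order))
      have z2 : w x < w p₆ := by
        by_contra hcon
        have := bl' p₆ x (lt_of_le_of_ne (not_lt.1 hcon) (hne _ _ (by order)).symm) z1.le
        order
      have := (hP p₁ p₂ p₃ x p₅ p₆ p₇ p₈ ⟨h12, h23, by order, h35, by order, h56, h67, h78, z2,
        v67, v71, v78, v12, v82, v23, v35⟩).1
      exact x1.ne (hdup _ _ _ a34 this)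
    · have := w.injective z
      order
    · rcases lt_trichotomy (w x) (w p₈) with z' | z' | z'
      · refine h67.ne (huniq p₃ x p₆ p₇ ⟨⟨by order, by order⟩, by order, by order⟩
          ⟨⟨by order, by order⟩, by order, by order⟩)
      · have := w.injective z'
        order
      · have z1 : w p₂ < w x := hadj _ _ _ b56 z' (hne _ _ (by order)).symm
        have z2 : w p₃ < w x := by
          by_contra hcon
          have := br' x p₃ z1.le (lt_of_le_of_ne (not_lt.1 hcon) (hne _ _ (by order)).symm)
          order
        have := (hP p₁ p₂ p₃ p₄ x p₆ p₇ p₈ ⟨h12, h23, h34, by order, h46, by order, h67, h78, v46,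
          v67, v71, v78, v12, v82, v23, z2⟩).2.1
        exact x2.ne (hdup' _ _ _ this a56)
  have g67 := val_succ_of_no_between h67 fun x x1 x2 => by
    have y1 : w p₆ < w x := ar _ _ le_rfl x1
    have y2 : w x < w p₇ := ar _ _ x1.le x2
    have := (hP p₁ p₂ p₃ p₄ p₅ x p₇ p₈ ⟨h12, h23, h34, h35, by order, by order, x2, h78, by order,
      y2, v71, v78, v12, v82, v23, v35⟩).2.1
    exact x1.ne (hdup _ _ _ a56 this)
  have g78 := val_succ_of_no_between h78 fun x x1 x2 => by
    have y1 : w p₇ < w x := ar _ _ h67.le x1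
    have y2 : w x < w p₈ := ar _ _ (by order) x2
    have := (hP p₁ p₂ p₃ p₄ p₅ p₆ p₇ x ⟨h12, h23, h34, h35, h46, h56, h67, x1, v46, v67, v71, y1,
      v12, by order, v23, v35⟩).2.2.2
    exact hne _ _ x2 (hdup' _ _ _ this b56)
  omega

theorem MinHex.eq_shift {n : ℕ} {w : Perm (Fin n)} (hw : MinHex w) (h : HasHex w) :
    ∃ (c : ℕ) (hc : c + 8 ≤ n),
      w * Equiv.Perm.viaEmbeddingHom (shiftEmb c hc) p46718235 = 1 := by
  obtain ⟨p₁, p₂, p₃, p₄, p₅, p₆, p₇, p₈, h⟩ := h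
  obtain ⟨c2, c3, c4, c5, c6, c7, c8⟩ := hw.consecutive h
  obtain ⟨d2, d3, d4, d5, d6, d7, d8⟩ := hw.inv.consecutive h.inv
  have hp := hw.pos h
  have hc : p₁.val + 8 ≤ n := by
    have := p₈.isLt
    omega
  refine ⟨p₁.val, hc, ?_⟩
  set φ := Equiv.Perm.viaEmbeddingHom (shiftEmb p₁.val hc) p46718235 with hφ
  have hin : ∀ j : Fin 8, (w (φ (shiftEmb p₁.val hc j))).val = (w p₄).val + j.val := by
    intro j
    rw [hφ, Equiv.Perm.viaEmbeddingHom_apply, Equiv.Perm.viaEmbedding_apply]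
    have key : ∀ (i : Fin 8) (p : Fin n), p.val = p₁.val + i.val →
        shiftEmb p₁.val hc i = p := fun i p hip => Fin.ext hip.symm
    fin_cases j
    · exact congrArg (fun x => (w x).val) (key 3 p₄ c4)
    · exact (congrArg (fun x => (w x).val) (key 5 p₆ c6)).trans d2
    · exact (congrArg (fun x => (w x).val) (key 6 p₇ c7)).trans d3
    · exact (congrArg (fun x => (w x).val) (key 0 p₁ rfl)).trans d4
    · exact (congrArg (fun x => (w x).val) (key 7 p₈ c8)).trans d5
    · exact (congrArg (fun x => (w x).val) (key 1 p₂ c2)).trans d6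
    · exact (congrArg (fun x => (w x).val) (key 2 p₃ c3)).trans d7
    · exact (congrArg (fun x => (w x).val) (key 4 p₅ c5)).trans d8
  have hout : ∀ x : Fin n, x.val < p₁.val ∨ p₁.val + 8 ≤ x.val → φ x = x := by
    intro x hx
    rw [hφ, Equiv.Perm.viaEmbeddingHom_apply, Equiv.Perm.viaEmbedding_apply_of_notMem]
    rintro ⟨j, rfl⟩
    rw [val_shiftEmb] at hx
    omega
  have hblock : ∀ x : Fin n, (x.val < p₁.val ∨ p₁.val + 8 ≤ x.val) →
      (w x).val < (w p₄).val ∨ (w p₄).val + 8 ≤ (w x).val := by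
    intro x hx
    by_contra hcon
    push Not at hcon
    have h1 := hin ⟨(w x).val - (w p₄).val, by omega⟩
    have h2 : w (φ (shiftEmb p₁.val hc ⟨(w x).val - (w p₄).val, by omega⟩)) = w (φ x) := by
      rw [hout x hx]
      ext
      rw [h1]
      simp only
      omega
    have h3 := φ.injective (w.injective h2)
    rw [← h3, val_shiftEmb] at hx
    omega
  have hlow : ∀ x : Fin n, x.val < p₁.val → (w x).val < (w p₄).val := by
    intro x hx
    have h1 := hp.mono_left x p₁ hx (h.h12.le.trans h.h23.le)
    have h2 := hblock x (Or.inl hx)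
    simp only [Fin.lt_def] at h1
    omega
  have hhigh : ∀ x : Fin n, p₁.val + 8 ≤ x.val → (w p₄).val + 8 ≤ (w x).val := by
    intro x hx
    have h1 := hp.mono_right p₈ x (h.h67.le.trans h.h78.le) (by simp only [Fin.lt_def]; omega)
    have h2 := hblock x (Or.inr hx)
    simp only [Fin.lt_def] at h1
    omega
  have hmid : ∀ x : Fin n, p₁.val ≤ x.val → x.val < p₁.val + 8 →
      (w (φ x)).val = (w p₄).val + (x.val - p₁.val) := by
    intro x h1 h2
    rw [← hin ⟨x.val - p₁.val, by omega⟩]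
    congr 3
    ext
    rw [val_shiftEmb]
    simp only
    omega
  refine eq_one_of_no_inv ?_
  rintro a b ⟨hab, hlt⟩
  simp only [Perm.mul_apply, Fin.lt_def] at hab hlt
  by_cases a1 : a.val < p₁.val
  · rw [hout a (Or.inl a1)] at hlt
    have := hlow a a1
    by_cases b1 : b.val < p₁.val
    · rw [hout b (Or.inl b1)] at hlt
      exact absurd hlt (not_lt.2 (Fin.lt_def.1 (hp.mono_left a b hab
        (Fin.le_def.2 (by omega)))).le)
    · by_cases b2 : p₁.val + 8 ≤ b.val
      · rw [hout b (Or.inr b2)] at hlt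
        have := hhigh b b2
        omega
      · have := hmid b (by omega) (by omega)
        omega
  · by_cases b2 : p₁.val + 8 ≤ b.val
    · have hb := hhigh b b2
      rw [hout b (Or.inr b2)] at hlt
      by_cases a2 : p₁.val + 8 ≤ a.val
      · rw [hout a (Or.inr a2)] at hlt
        exact absurd hlt (not_lt.2 (Fin.lt_def.1 (hp.mono_right a b (Fin.le_def.2 (by omega))
          hab)).le)
      · have := hmid a (by omega) (by omega)
        omega
    · have h1 := hmid a (by omega) (by omega)
      have h2 := hmid b (by omega) (by omega)
      omega

theorem heapContains_of_eq_shift {n c : ℕ} (hc : c + 8 ≤ n) :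
    HeapContains (Equiv.Perm.viaEmbeddingHom (shiftEmb c hc) p46718235) p46718235 := by
  obtain ⟨y, hy, hl⟩ := exists_expr p46718235
  have hr : IsReduced y := isReduced_iff.2 (by rw [hy, hl])
  have hf : ∀ i : Fin (8 - 1), ((⟨c + i.val, by omega⟩ : Fin (n - 1))).val = c + i.val :=
    fun _ => rfl
  refine (heapContains_iff _ _).2 ⟨[], [], y, fun i => ⟨c + i.val, by omega⟩, ⟨?_, ?_⟩, ⟨hy, hr⟩,
    isCoxeterEmbedding_of_shift hc hf⟩
  · rw [List.nil_append, List.append_nil, eval_map_shift hc hf, hy]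
  · rw [List.nil_append, List.append_nil]
    exact hr.map_shift hc hf

theorem HeapContains.of_gen_mul {n k : ℕ} {w : Perm (Fin n)} {p : Perm (Fin k)} {i : Fin (n - 1)}
    (hi : len (gen i * w) + 1 = len w) (h : HeapContains (gen i * w) p) : HeapContains w p := by
  obtain ⟨D, U, y, f, ⟨h1, h2⟩, hy, hf⟩ := (heapContains_iff _ _).1 h
  rw [isReduced_iff, h1] at h2
  have h3 : Expr.eval (i :: D ++ (y.map f ++ U) : Expr n) = w := by
    rw [List.cons_append, eval_cons, h1, ← mul_assoc, gen_mul_gen, one_mul]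
  refine (heapContains_iff _ _).2 ⟨i :: D, U, y, f, ⟨h3, ?_⟩, hy, hf⟩
  rw [isReduced_iff, h3, ← hi, h2]
  rfl

theorem HeapContains.of_mul_gen {n k : ℕ} {w : Perm (Fin n)} {p : Perm (Fin k)} {i : Fin (n - 1)}
    (hi : len (w * gen i) + 1 = len w) (h : HeapContains (w * gen i) p) : HeapContains w p := by
  obtain ⟨D, U, y, f, ⟨h1, h2⟩, hy, hf⟩ := (heapContains_iff _ _).1 h
  rw [isReduced_iff, h1] at h2
  have e : D ++ (y.map f ++ (U ++ [i])) = (D ++ (y.map f ++ U)) ++ [i] := by simp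
  have h3 : Expr.eval (D ++ (y.map f ++ (U ++ [i])) : Expr n) = w := by
    rw [e, eval_append, h1, eval_cons, eval_nil, mul_one, mul_assoc, gen_mul_gen, mul_one]
  refine (heapContains_iff _ _).2 ⟨D, U ++ [i], y, f, ⟨h3, ?_⟩, hy, hf⟩
  rw [isReduced_iff, h3, ← hi, h2, e]
  simp [add_assoc]

theorem heapContains_of_hasHex {n : ℕ} {w : Perm (Fin n)} (hl : UniqueLast w)
    (hf : UniqueFirst w) (h : HasHex w) : HeapContains w p46718235 := by
  induction hm : len w using Nat.strong_induction_on generalizing w with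
  | _ m ih =>
    by_cases hR : ∃ k : Fin (n - 1), w (hi k) < w (lo k) ∧ HasHex (w * gen k)
    · obtain ⟨k, hk, hh⟩ := hR
      have hk' : w⁻¹⁻¹ (hi k) < w⁻¹⁻¹ (lo k) := by rwa [inv_inv]
      have h1 := len_gen_mul_of_descent hk'
      have h2 := unique_gen_mul hf.inv hl.inv hk'
      have e : (gen k * w⁻¹)⁻¹ = w * gen k := by rw [mul_inv_rev, inv_inv, gen_inv]
      have h3 := h2.2.inv
      have h4 := h2.1.inv
      rw [← len_inv, e, len_inv] at h1
      rw [e] at h3 h4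
      exact (ih _ (by omega) h3 h4 hh rfl).of_mul_gen h1
    · by_cases hL : ∃ k : Fin (n - 1), w⁻¹ (hi k) < w⁻¹ (lo k) ∧ HasHex (w⁻¹ * gen k)
      · obtain ⟨k, hk, hh⟩ := hL
        have h1 := len_gen_mul_of_descent hk
        have h2 := unique_gen_mul hl hf hk
        have h3 := hh.inv
        rw [mul_inv_rev, inv_inv, gen_inv] at h3
        exact (ih _ (by omega) h2.1 h2.2 h3 rfl).of_gen_mul h1
      · push Not at hR hL
        have hmin : MinHex w⁻¹ := MinHex.inv ⟨hl, hf, hR, hL⟩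
        obtain ⟨c, hc, he⟩ := hmin.eq_shift h.inv
        rw [inv_mul_eq_one] at he
        rw [he]
        exact heapContains_of_eq_shift hc

theorem hexagonAvoiding_iff {n : ℕ} {w : Perm (Fin n)} (h : UniqueLast w ∧ UniqueFirst w) :
    HexagonAvoiding w ↔ (Avoids w p46718235 ∧ Avoids w p46781235 ∧ Avoids w p56718234 ∧
      Avoids w p56781234) := by
  rw [← hasHex_iff, HexagonAvoiding, not_iff_not]
  exact ⟨hasHex_of_heapContains h.1 h.2, heapContains_of_hasHex h.1 h.2⟩

end HexPerm

theorem corollary4p5 (n : ℕ) (w : Equiv.Perm (Fin n)) :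
    ((HexPerm.FreelyBraided w ∧ HexPerm.HexagonAvoiding w) ↔
      (HexPerm.Avoids w HexPerm.p3421 ∧ HexPerm.Avoids w HexPerm.p4231 ∧
        HexPerm.Avoids w HexPerm.p4312 ∧ HexPerm.Avoids w HexPerm.p4321 ∧
        HexPerm.Avoids w HexPerm.p46718235 ∧ HexPerm.Avoids w HexPerm.p46781235 ∧
        HexPerm.Avoids w HexPerm.p56718234 ∧ HexPerm.Avoids w HexPerm.p56781234)) ∧
    ((HexPerm.MaximallyClustered w ∧ HexPerm.HexagonAvoiding w) ↔
      (HexPerm.Avoids w HexPerm.p3421 ∧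
        HexPerm.Avoids w HexPerm.p4312 ∧ HexPerm.Avoids w HexPerm.p4321 ∧
        HexPerm.Avoids w HexPerm.p46718235 ∧ HexPerm.Avoids w HexPerm.p46781235 ∧
        HexPerm.Avoids w HexPerm.p56718234 ∧ HexPerm.Avoids w HexPerm.p56781234)) := by
  have h0 := HexPerm.unique_iff_avoids w
  constructor
  · rw [HexPerm.freelyBraided_iff]
    constructor
    · rintro ⟨⟨h1, h2⟩, h3⟩
      obtain ⟨a1, a2, a3⟩ := h0.1 h1
      exact ⟨a1, h2.avoids, a2, a3, (HexPerm.hexagonAvoiding_iff h1).1 h3⟩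
    · rintro ⟨a1, a2, a3, a4, a5⟩
      have h1 := h0.2 ⟨a1, a3, a4⟩
      exact ⟨⟨h1, HexPerm.uniqueMid_of_avoids a2 a4⟩, (HexPerm.hexagonAvoiding_iff h1).2 a5⟩
  · rw [HexPerm.maximallyClustered_iff]
    constructor
    · rintro ⟨h1, h3⟩
      obtain ⟨a1, a2, a3⟩ := h0.1 h1
      exact ⟨a1, a2, a3, (HexPerm.hexagonAvoiding_iff h1).1 h3⟩
    · rintro ⟨a1, a3, a4, a5⟩
      have h1 := h0.2 ⟨a1, a3, a4⟩
      exact ⟨h1, (HexPerm.hexagonAvoiding_iff h1).2 a5⟩
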